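/- Let $n\ge 2$, $\ell>0$, $0<\alpha\le 1$, and let $\varphi:(-\tfrac{3\ell}{2},\tfrac{3\ell}{2})^{n-1}\to\mathbb R$ satisfy $|\varphi(x')-\varphi(y')|\le K|x'-y'|^\alpha$ for all $x',y'$ and $2\ell\le\varphi<3\ell$. Put $$\Omega_\varphi=\{(x',x_n): x'\in(-\tfrac{\ell}{2},\tfrac{\ell}{2})^{n-1},\ 0<x_n<\varphi(x')\},\qquad G=\{(x',\varphi(x')): x'\in(-\tfrac{3\ell}{2},\tfrac{3\ell}{2})^{n-1}\},$$ and let $d_G$ be the Euclidean distance to $G$. Definitions. An open covering of $\Omega_\varphi$ is a family of open sets $U_t\subset\Omega_\varphi$ $(t\in\Gamma)$ that covers $\Omega_\varphi$ up to a null set and such that each $U_t$ meets only finitely many $U_s$. It is a tree covering if $\sum_t\chi_{U_t}\le N$ a.e. for some $N$, $\Gamma$ is the vertex set of a tree with a root $a$ in which every vertex has finitely many children, and there are pairwise disjoint open sets $B_t$ $(t\ne a)$ with $B_t\subset U_t\cap U_{t_p}$, where $t_p$ is the parent of $t$. A $\mathcal C$-decomposition of $f\in L^1(\Omega_\varphi)$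 with $\int_{\Omega_\varphi} f=0$, subordinate to $\{U_t\}$, is a family $f_t\in L^1(\Omega_\varphi)$ with $f=\sum_t f_t$ a.e., $f_t=0$ outside $U_t$, and $\int_{U_t}f_t=0$ for every $t$. Claim. There is a tree covering $\{U_t\}_{t\in\Gamma}$ of $\Omega_\varphi$ of Whitney type, in the following sense. There are pairwise disjoint open cubes $Q_t=Q_t'\times(h_t,h_t+\ell_t)$ with edge $\ell_t$ and sides parallel to the axes, which cover $\Omega_\varphi$ up to a null set, such that $U_a=Q_a$ and, for $t\neq a$, $U_t=Q_t'\times(h_t-\tfrac{\ell_t}{2},h_t+\ell_t)$ and $B_t=Q_t'\times(h_t-\tfrac{\ell_t}{2},h_t)$; and there are constants $c_1,c_2>0$ with $c_1\ell_t\le d_G\le c_2\ell_t$ on $U_t$ for every $t$. For this covering the following holds. Let $1<p,q<\infty$ with $\frac1p+\frac1q=1$, and let $\beta\in\mathbb R$ satisfy $\beta p>-\alpha$. Then there is a constant $C$ such that every $f\in L^q(\Omega_\varphi,d_G^{-\beta q})$ (that is, $f$ measurable with $\int_{\Omega_\varphi}|f|^q d_G^{-\beta q}<\infty$) with $\int_{\Omega_\varphi}f=0$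 is in $L^1(\Omega_\varphi)$ and has a $\mathcal C$-decomposition $\{f_t\}_{t\in\Gamma}$ subordinate to $\{U_t\}$ with $$\sum_{t\in\Gamma}\int_{U_t}|f_t|^q\,\nu^{-q}\,dx\le C\int_{\Omega_\varphi}|f|^q\,\omega^{-q}\,dx,\qquad \omega=d_G^{\beta},\quad \nu=d_G^{\beta+\alpha-1}.$$ -/

import Mathlib

open MeasureTheory Set
open scoped NNReal ENNReal

namespace HolderDecomposition

/-- The space `ℝᵏ` with its Euclidean norm. -/
abbrev Eucl (k : ℕ) : Type := EuclideanSpace ℝ (Fin k)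

/-! ### Rooted trees -/

/-- `s ⪯ t` in the tree `T` with root `a`: the (unique) path from `t` to the root passes
through `s`. -/
def Precedes {Γ : Type*} (T : SimpleGraph Γ) (a s t : Γ) : Prop :=
  ∃ w : T.Walk t a, w.IsPath ∧ s ∈ w.support

/-- `s` is the parent of `t`: it is the neighbour of `t` on the path from `t` to the root. -/
def IsParent {Γ : Type*} (T : SimpleGraph Γ) (a s t : Γ) : Prop :=
  T.Adj s t ∧ Precedes T a s t

/-! ### Coverings and decompositions -/

/-- An open covering of `Ω`: open subsets of `Ω` that cover `Ω` up to a null set, each of which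
meets only finitely many of the others. -/
structure IsOpenCovering {Γ : Type*} {k : ℕ} (Ω : Set (Eucl k)) (U : Γ → Set (Eucl k)) :
    Prop where
  isOpen : ∀ t, IsOpen (U t)
  subset : ∀ t, U t ⊆ Ω
  ae_cover : volume (Ω \ ⋃ t, U t) = 0
  finite_inter : ∀ t, {s | (U t ∩ U s).Nonempty}.Finite

/-- A tree covering `{U_t}` of `Ω`, indexed by the vertices of the tree `T` with root `a`,
together with the sets `B_t`, `t ≠ a` (the value of `B` at the root is irrelevant). -/
structure IsTreeCovering {Γ : Type*} {k : ℕ} (Ω : Set (Eucl k)) (T : SimpleGraph Γ) (a : Γ)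
    (U B : Γ → Set (Eucl k)) : Prop extends IsOpenCovering Ω U where
  overlap : ∃ N : ℕ, 1 ≤ N ∧ ∀ᵐ x ∂(volume.restrict Ω),
    Ω.indicator (1 : Eucl k → ℝ≥0∞) x ≤ ∑' t, (U t).indicator (1 : Eucl k → ℝ≥0∞) x ∧
    ∑' t, (U t).indicator (1 : Eucl k → ℝ≥0∞) x ≤ N * Ω.indicator (1 : Eucl k → ℝ≥0∞) x
  isTree : T.IsTree
  finite_children : ∀ s, {t | IsParent T a s t}.Finite
  isOpen_B : ∀ t, t ≠ a → IsOpen (B t)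
  disjoint_B : ∀ s t, s ≠ a → t ≠ a → s ≠ t → Disjoint (B s) (B t)
  B_subset : ∀ s t, IsParent T a s t → B t ⊆ U t ∩ U s

/-- `{g_t}` is a `𝒞`-decomposition of the mean-zero function `g ∈ L¹(Ω)` subordinate
to `{U_t}`. That `g_t` is supported in `U_t` means that it vanishes off `U_t`. -/
structure IsCDecomposition {Γ : Type*} {k : ℕ} (Ω : Set (Eucl k)) (U : Γ → Set (Eucl k))
    (g : Eucl k → ℝ) (gs : Γ → Eucl k → ℝ) : Prop where
  integrable : IntegrableOn g Ω
  mean_zero : ∫ x in Ω, g x = 0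
  integrable_part : ∀ t, IntegrableOn (gs t) Ω
  hasSum : ∀ᵐ x ∂(volume.restrict Ω), HasSum (fun t => gs t x) (g x)
  support : ∀ t, Function.support (gs t) ⊆ U t
  part_mean_zero : ∀ t, ∫ x in U t, gs t x = 0

/-- Membership in the weighted space `L^r(Ω, η)`, with norm `(∫_Ω |f|^r η)^{1/r}`. -/
def MemWeightedLp {k : ℕ} (Ω : Set (Eucl k)) (η : Eucl k → ℝ) (r : ℝ) (f : Eucl k → ℝ) : Prop :=
  AEStronglyMeasurable f (volume.restrict Ω) ∧ IntegrableOn (fun x => |f x| ^ r * η x) Ω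

/-- `∑_t ∫_{U_t} |g_t|^q ν^{-q} ≤ C ∫_Ω |g|^q ω^{-q}`, as an inequality in `[0, ∞]`. -/
def DecompositionEstimate {Γ : Type*} {k : ℕ} (Ω : Set (Eucl k)) (U : Γ → Set (Eucl k))
    (ω ν : Eucl k → ℝ) (q : ℝ) (C : ℝ≥0) (g : Eucl k → ℝ) (gs : Γ → Eucl k → ℝ) : Prop :=
  ∑' t, ∫⁻ x in U t, ENNReal.ofReal (|gs t x| ^ q * ν x ^ (-q)) ≤
    C * ∫⁻ x in Ω, ENNReal.ofReal (|g x| ^ q * ω x ^ (-q))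

/-! ### The region below a graph; points of `ℝ^{m+1}` are `x = (x', x_n)`, `n = m + 1` -/

/-- The first `m` coordinates `x'` of `x`. -/
def horiz {m : ℕ} (x : Eucl (m + 1)) : Eucl m := WithLp.toLp 2 fun i => x i.castSucc

/-- The last coordinate `x_n` of `x`. -/
def vert {m : ℕ} (x : Eucl (m + 1)) : ℝ := x (Fin.last m)

/-- The open cube `(-r, r)^k`. -/
def centeredCube (k : ℕ) (r : ℝ) : Set (Eucl k) := {y | ∀ i, -r < y i ∧ y i < r}

/-- The region `Ω_φ` below the graph of `φ` over `(-ℓ/2, ℓ/2)^m`. -/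
def graphRegion {m : ℕ} (ℓ : ℝ) (φ : Eucl m → ℝ) : Set (Eucl (m + 1)) :=
  {x | horiz x ∈ centeredCube m (ℓ / 2) ∧ 0 < vert x ∧ vert x < φ (horiz x)}

/-- The graph `G` of `φ` over the larger cube `(-3ℓ/2, 3ℓ/2)^m`. -/
def bigGraph {m : ℕ} (ℓ : ℝ) (φ : Eucl m → ℝ) : Set (Eucl (m + 1)) :=
  {x | horiz x ∈ centeredCube m (3 * ℓ / 2) ∧ vert x = φ (horiz x)}

/-- The distance `d_G` to the graph `G`. -/
noncomputable def distGraph {m : ℕ} (ℓ : ℝ) (φ : Eucl m → ℝ) (x : Eucl (m + 1)) : ℝ :=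
  Metric.infDist x (bigGraph ℓ φ)

/-- The open box `∏_{i ≤ m} (z_i, z_i + e) × (z_n + lo, z_n + hi)`. -/
def box {m : ℕ} (z : Eucl (m + 1)) (e lo hi : ℝ) : Set (Eucl (m + 1)) :=
  {x | (∀ i : Fin m, z i.castSucc < x i.castSucc ∧ x i.castSucc < z i.castSucc + e) ∧
    vert z + lo < vert x ∧ vert x < vert z + hi}

/-- The covering is of Whitney type with respect to `d`: there are pairwise disjoint open cubes
`Q_t` with lowest corner `z t` and edge `e t`, covering `Ω` up to a null set, such that `U_a` is
the root cube, any other `U_t` is `Q_t` extended downward by half its edge, `B_t` is the added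
part, and `e t` is proportional to `d` on `U_t`, uniformly in `t`. -/
structure IsWhitneyType {Γ : Type*} {m : ℕ} (Ω : Set (Eucl (m + 1))) (d : Eucl (m + 1) → ℝ)
    (a : Γ) (U B : Γ → Set (Eucl (m + 1))) (z : Γ → Eucl (m + 1)) (e : Γ → ℝ) : Prop where
  edge_pos : ∀ t, 0 < e t
  disjoint_cubes : ∀ s t, s ≠ t → Disjoint (box (z s) (e s) 0 (e s)) (box (z t) (e t) 0 (e t))
  ae_cover_cubes : volume (Ω \ ⋃ t, box (z t) (e t) 0 (e t)) = 0
  root_eq : U a = box (z a) (e a) 0 (e a)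
  U_eq : ∀ t, t ≠ a → U t = box (z t) (e t) (-(e t / 2)) (e t)
  B_eq : ∀ t, t ≠ a → B t = box (z t) (e t) (-(e t / 2)) 0
  edge_comparable : ∃ c₁ c₂ : ℝ, 0 < c₁ ∧ 0 < c₂ ∧
    ∀ t, ∀ x ∈ U t, c₁ * e t ≤ d x ∧ d x ≤ c₂ * e t

end HolderDecomposition

/-!
The covering consists of the maximal dyadic cubes `Q = Q' × (h, h + e)` over the base of `Ω_φ`
that satisfy `h + 2 e ≤ φ` on the cube three times as large as `Q'` (`IsGood`, `IsWhitney`). By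
maximality they are disjoint, and as `φ` is continuous they exhaust `Ω_φ` up to dyadic hyperplanes
(`exists_mem_cell`). The condition passes to lower cubes, so the cube just below a maximal cube lies
in a maximal cube, its parent (`WhitneyIndex.exists_parent`). Since `2 ℓ ≤ φ`, the cube
`(-ℓ/2, ℓ/2)^m × (0, ℓ)` is maximal; it contains all cubes of the bottom layer, so it is the root.
Goodness gives `e ≤ d_G` on the extended cubes, and maximality gives `d_G ≤ 5 (m + 1) e`; as `φ` is
only Hölder continuous, the latter needs the intermediate value theorem (`exists_graph_point`).

The decomposition moves mass down the tree. For `t ≠ a` let `F_t` be the integral of `f` over the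
shadow of `t`, the union of the cubes of its descendants, and let `G = F_t / |B_t|` on `B_t` and
`G = 0` off these sets. Then `f_t = 1_{Q_t} (f + G) - 1_{B_t} G` has mean zero, since the mass of a
shadow is that of its cube plus those of the shadows of the children (`integral_cellPart`), and the
`f_t` sum to `f` because the `B_t` are disjoint and lie in the cubes of the parents
(`hasSum_cellPart`).

The estimate thus reduces to a discrete Hardy inequality for the masses of the shadows,
`∑_t w_t (∑_{s ⪰ t} A_s)^q ≤ C ∑_s v_s A_s^q` with `A_s = ∫_{Q_s} |f|` and with powers of the edges
as weights (`discrete_hardy`). It follows from Schur's test (`tsum_rpow_le_of_schur`) and one fact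
about the tree: a column contains at most `M e^(α - 1)` cubes of edge `e`
(`exists_column_bound`), because by Hölder continuity these cubes lie at distance at most a multiple
of `e^α` below the graph. The geometric series over descendants and over ancestors converge for a
common choice of the auxiliary weight exactly when `β p > -α`. The Hardy inequality at the root
also shows that `f` is integrable.
-/

namespace HolderDecomposition

/-! ### Trees given by a parent map -/

section ParentMap

variable {Γ : Type*} {par : Γ → Γ} {rank : Γ → ℕ} {a : Γ}

/-- `s` descends from `t` under the parent map `par`; every vertex descends from itself. -/
def Descends (par : Γ → Γ) (t s : Γ) : Prop := ∃ n, par^[n] s = t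

/-- The graph joining every vertex to its parent (loops removed). -/
def parentGraph (par : Γ → Γ) : SimpleGraph Γ := SimpleGraph.fromRel fun s t => par t = s

lemma Descends.refl (t : Γ) : Descends par t t := ⟨0, rfl⟩

lemma Descends.of_par {t s : Γ} (h : Descends par t (par s)) : Descends par t s := by
  obtain ⟨n, hn⟩ := h
  exact ⟨n + 1, by simpa using hn⟩

lemma Descends.par_left {t s : Γ} (h : Descends par t s) : Descends par (par t) s := by
  obtain ⟨n, hn⟩ := h
  exact ⟨n + 1, by rw [Function.iterate_succ_apply', hn]⟩

lemma Descends.par_right {t s : Γ} (h : Descends par t s) (hne : s ≠ t) :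
    Descends par t (par s) := by
  obtain ⟨n, hn⟩ := h
  cases n with
  | zero => exact absurd hn hne
  | succ n => exact ⟨n, by simpa using hn⟩

lemma Descends.rank_le (ha : par a = a) (hlt : ∀ t, t ≠ a → rank (par t) < rank t) {t s : Γ}
    (h : Descends par t s) : rank t ≤ rank s := by
  have key : ∀ s, rank (par s) ≤ rank s := fun s => by
    by_cases hs : s = a
    · rw [hs, ha]
    · exact (hlt s hs).le
  obtain ⟨n, hn⟩ := h
  induction n generalizing s with
  | zero => exact le_of_eq (congrArg rank hn.symm)
  | succ n ih => exact (ih (s := par s) (by simpa using hn)).trans (key s)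

lemma descends_root (hlt : ∀ t, t ≠ a → rank (par t) < rank t) (s : Γ) : Descends par a s := by
  induction h : rank s using Nat.strong_induction_on generalizing s with
  | _ n ih =>
    by_cases hs : s = a
    · rw [hs]; exact .refl a
    · exact (ih _ (h ▸ hlt s hs) (par s) rfl).of_par

lemma Descends.total {t t' s : Γ} (h : Descends par t s) (h' : Descends par t' s) :
    Descends par t t' ∨ Descends par t' t := by
  obtain ⟨n, rfl⟩ := h
  obtain ⟨n', rfl⟩ := h'
  rcases le_total n n' with hn | hn
  · refine Or.inr ⟨n' - n, ?_⟩
    rw [← Function.iterate_add_apply, Nat.sub_add_cancel hn]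
  · refine Or.inl ⟨n - n', ?_⟩
    rw [← Function.iterate_add_apply, Nat.sub_add_cancel hn]

/-- The descendants of `t` are `t` and the descendants of its children. -/
lemma descends_iff (ha : par a = a) (hlt : ∀ t, t ≠ a → rank (par t) < rank t) {t s : Γ} :
    Descends par t s ↔ s = t ∨ ∃ c, (c ≠ a ∧ par c = t) ∧ Descends par c s := by
  constructor
  · intro h
    induction hr : rank s using Nat.strong_induction_on generalizing s with
    | _ n ih =>
      by_cases hst : s = t
      · exact Or.inl hst
      · have h' := h.par_right hst
        by_cases hs : s = a
        · subst hs
          have h1 := h.rank_le ha hlt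
          have h2 := (descends_root hlt t).rank_le ha hlt
          by_cases hta : t = s
          · exact Or.inl hta.symm
          · have h3 := ((descends_root hlt t).par_right hta).rank_le ha hlt
            have := hlt t hta
            omega
        · rcases ih _ (hr ▸ hlt s hs) h' rfl with h'' | ⟨c, hc, hcs⟩
          · exact Or.inr ⟨s, ⟨hs, h''⟩, .refl s⟩
          · exact Or.inr ⟨c, hc, hcs.of_par⟩
  · rintro (rfl | ⟨c, ⟨-, rfl⟩, h⟩)
    · exact .refl _
    · exact h.par_left

lemma not_descends_of_par_eq (ha : par a = a) (hlt : ∀ t, t ≠ a → rank (par t) < rank t)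
    {t c : Γ} (hc : c ≠ a) (hct : par c = t) : ¬ Descends par c t := fun h => by
  have h1 := h.rank_le ha hlt
  have h2 := hlt c hc
  rw [hct] at h2
  omega

/-- A vertex descends from at most one of the children of `t`. -/
lemma Descends.child_unique (ha : par a = a) (hlt : ∀ t, t ≠ a → rank (par t) < rank t)
    {t c c' s : Γ} (hc : c ≠ a ∧ par c = t) (hc' : c' ≠ a ∧ par c' = t)
    (h : Descends par c s) (h' : Descends par c' s) : c = c' := by
  by_contra hne
  rcases h.total h' with h'' | h''
  · exact not_descends_of_par_eq ha hlt hc.1 hc.2 (hc'.2 ▸ h''.par_right (Ne.symm hne))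
  · exact not_descends_of_par_eq ha hlt hc'.1 hc'.2 (hc.2 ▸ h''.par_right hne)

lemma exists_isPath_root (hlt : ∀ t, t ≠ a → rank (par t) < rank t) (t : Γ) :
    ∃ w : (parentGraph par).Walk t a, w.IsPath ∧ ∀ s ∈ w.support, rank s ≤ rank t := by
  induction h : rank t using Nat.strong_induction_on generalizing t with
  | _ n ih =>
    by_cases ht : t = a
    · subst ht
      exact ⟨.nil, by simp, by simp [h]⟩
    · have hr := hlt t ht
      obtain ⟨w, hw, hws⟩ := ih _ (h ▸ hr) (par t) rfl
      have hadj : (parentGraph par).Adj t (par t) := by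
        rw [parentGraph, SimpleGraph.fromRel_adj]
        exact ⟨fun h' => by rw [← h'] at hr; exact lt_irrefl _ hr, Or.inr rfl⟩
      refine ⟨.cons hadj w, ?_, ?_⟩
      · rw [SimpleGraph.Walk.cons_isPath_iff]
        exact ⟨hw, fun h' => by have := hws t h'; omega⟩
      · intro s hs
        rw [SimpleGraph.Walk.support_cons, List.mem_cons] at hs
        rcases hs with rfl | hs
        · omega
        · have := hws s hs; omega

/-- Every edge joins a vertex to its parent and is a bridge: the descendants of the lower end are
not connected to the rest once it is removed. -/
lemma parentGraph_isTree (ha : par a = a) (hlt : ∀ t, t ≠ a → rank (par t) < rank t) :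
    (parentGraph par).IsTree := by
  have hbridge : ∀ t, par t ≠ t → (parentGraph par).IsBridge s(t, par t) := by
    intro t ht
    have hta : t ≠ a := fun h => ht (by rw [h, ha])
    rw [SimpleGraph.isBridge_iff]
    intro hreach
    have inv : ∀ x y, ((parentGraph par).deleteEdges {s(t, par t)}).Adj x y →
        (Descends par t x → Descends par t y) := by
      intro x y hxy hx
      rw [SimpleGraph.deleteEdges_adj, parentGraph, SimpleGraph.fromRel_adj] at hxy
      obtain ⟨⟨hne, h | h⟩, he⟩ := hxy
      · exact Descends.of_par (h ▸ hx)
      · refine h ▸ hx.par_right fun hxt => he ?_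
        subst hxt
        simp [h]
    have : ∀ x, ((parentGraph par).deleteEdges {s(t, par t)}).Reachable t x →
        Descends par t x := by
      rintro x ⟨w⟩
      have : ∀ u v, ∀ w : ((parentGraph par).deleteEdges {s(t, par t)}).Walk u v,
          Descends par t u → Descends par t v := by
        intro u v w
        induction w with
        | nil => exact id
        | cons h _ ih => exact fun hu => ih (inv _ _ h hu)
      exact this _ _ w (.refl t)
    exact not_descends_of_par_eq ha hlt hta rfl (this _ hreach)
  refine ⟨?_, ?_⟩
  · have : Nonempty Γ := ⟨a⟩
    refine SimpleGraph.Connected.mk fun s t => ?_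
    obtain ⟨w, -⟩ := exists_isPath_root hlt s
    obtain ⟨w', -⟩ := exists_isPath_root hlt t
    exact ⟨w.append w'.reverse⟩
  · rw [SimpleGraph.isAcyclic_iff_forall_adj_isBridge]
    intro v w hvw
    rw [parentGraph, SimpleGraph.fromRel_adj] at hvw
    obtain ⟨hne, h | h⟩ := hvw
    · rw [Sym2.eq_swap]
      subst h
      exact hbridge _ hne
    · subst h
      exact hbridge _ hne.symm

/-- The parent of `t` in the rooted tree `parentGraph par` is `par t`. -/
lemma IsParent.par_eq (ha : par a = a) (hlt : ∀ t, t ≠ a → rank (par t) < rank t) {s t : Γ}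
    (h : IsParent (parentGraph par) a s t) : t ≠ a ∧ par t = s := by
  obtain ⟨hadj, w, hw, hs⟩ := h
  obtain ⟨w', hw', hle⟩ := exists_isPath_root hlt t
  have hww : w = w' := congrArg Subtype.val
    (((parentGraph_isTree ha hlt).isAcyclic.subsingleton_path t a).elim ⟨w, hw⟩ ⟨w', hw'⟩)
  rw [parentGraph, SimpleGraph.fromRel_adj] at hadj
  obtain ⟨hne, h | h⟩ := hadj
  · refine ⟨fun hta => hne ?_, h⟩
    rw [← h, hta, ha]
  · have hsa : s ≠ a := fun hsa => hne (by rw [← h, hsa, ha])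
    have h1 := hlt s hsa
    have h2 := hle s (hww ▸ hs)
    rw [h] at h1
    omega

end ParentMap

/-! ### Decompositions along a tree of cells -/

/-- Disjoint cells `Q t`, indexed by the vertices of a tree given by its parent map, together with
disjoint bridges `B t` of finite positive measure, `t ≠ a`, each contained in the cell of the
parent. The bridge of the root is empty. -/
structure IsCellTree {X Γ : Type*} [MeasurableSpace X] (μ : Measure X) (par : Γ → Γ)
    (rank : Γ → ℕ) (a : Γ) (Q B : Γ → Set X) : Prop where
  par_root : par a = a
  rank_lt : ∀ t, t ≠ a → rank (par t) < rank t
  finite_children : ∀ t, {c | c ≠ a ∧ par c = t}.Finite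
  measurable_Q : ∀ t, MeasurableSet (Q t)
  measurable_B : ∀ t, MeasurableSet (B t)
  disjoint_Q : Pairwise (Function.onFun Disjoint Q)
  disjoint_B : Pairwise (Function.onFun Disjoint B)
  B_root : B a = ∅
  B_subset : ∀ t, t ≠ a → B t ⊆ Q (par t)
  measure_B_ne_zero : ∀ t, t ≠ a → μ (B t) ≠ 0
  measure_B_ne_top : ∀ t, μ (B t) ≠ ∞

section CellTree

variable {X Γ : Type*} [MeasurableSpace X] {μ : Measure X} {par : Γ → Γ}
  {rank : Γ → ℕ} {a : Γ} {Q B : Γ → Set X} {f : X → ℝ}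

/-- The shadow of `t`: the union of the cells of the descendants of `t`. -/
def shadow (par : Γ → Γ) (Q : Γ → Set X) (t : Γ) : Set X := ⋃ s ∈ {s | Descends par t s}, Q s

/-- The mean value on the bridge `B t` that carries the mass of `f` on the shadow of `t`. -/
noncomputable def flux (μ : Measure X) (par : Γ → Γ) (Q B : Γ → Set X) (f : X → ℝ) (t : Γ) : ℝ :=
  (∫ x in shadow par Q t, f x ∂μ) / μ.real (B t)

/-- The function equal to `flux t` on each bridge `B t`, and to `0` off the bridges. -/
noncomputable def transfer (μ : Measure X) (par : Γ → Γ) (Q B : Γ → Set X) (f : X → ℝ)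
    (x : X) : ℝ :=
  ∑' t, (B t).indicator (fun _ => flux μ par Q B f t) x

/-- The part of `f` at `t`: `f` on the cell of `t`, plus the masses received from the shadows of
the children, minus the mass handed down to the parent. -/
noncomputable def cellPart (μ : Measure X) (par : Γ → Γ) (Q B : Γ → Set X) (f : X → ℝ) (t : Γ)
    (x : X) : ℝ :=
  (Q t).indicator (fun x => f x + transfer μ par Q B f x) x -
    (B t).indicator (transfer μ par Q B f) x

lemma measurableSet_shadow [Countable Γ] (h : IsCellTree μ par rank a Q B) (t : Γ) :
    MeasurableSet (shadow par Q t) :=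
  .biUnion (to_countable _) fun s _ => h.measurable_Q s

lemma transfer_eq (h : IsCellTree μ par rank a Q B) {t : Γ} {x : X} (hx : x ∈ B t) :
    transfer μ par Q B f x = flux μ par Q B f t := by
  rw [transfer, tsum_eq_single t, indicator_of_mem hx]
  intro s hs
  exact indicator_of_notMem (fun hxs => (h.disjoint_B hs).le_bot ⟨hxs, hx⟩) _

lemma transfer_eq_zero {x : X} (hx : ∀ t, x ∉ B t) : transfer μ par Q B f x = 0 := by
  rw [transfer, ← tsum_zero (β := Γ)]
  exact tsum_congr fun t => indicator_of_notMem (hx t) _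

lemma mem_child (h : IsCellTree μ par rank a Q B) {t c : Γ} {x : X} (hx : x ∈ Q t)
    (hc : x ∈ B c) : c ≠ a ∧ par c = t := by
  have hca : c ≠ a := by
    rintro rfl
    rw [h.B_root] at hc
    exact hc
  refine ⟨hca, ?_⟩
  by_contra hne
  exact (h.disjoint_Q hne).le_bot ⟨h.B_subset c hca hc, hx⟩

lemma disjoint_Q_B (h : IsCellTree μ par rank a Q B) (t : Γ) : Disjoint (Q t) (B t) := by
  rw [Set.disjoint_left]
  intro x hx hb
  obtain ⟨h1, h2⟩ := mem_child h hx hb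
  have := h.rank_lt t h1
  rw [h2] at this
  exact lt_irrefl _ this

/-- On the cell of `t` only the bridges of the children of `t` contribute to `transfer`. -/
lemma indicator_transfer (h : IsCellTree μ par rank a Q B) (t : Γ) :
    (Q t).indicator (transfer μ par Q B f) = fun x =>
      ∑ c ∈ (h.finite_children t).toFinset, (B c).indicator (fun _ => flux μ par Q B f c) x := by
  ext x
  by_cases hx : x ∈ Q t
  · rw [indicator_of_mem hx, transfer, tsum_eq_sum]
    intro c hc
    refine indicator_of_notMem (fun hxc => hc ?_) _
    simpa using mem_child h hx hxc
  · rw [indicator_of_notMem hx]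
    refine (Finset.sum_eq_zero fun c hc => indicator_of_notMem (fun hxc => hx ?_) _).symm
    have hc' : c ≠ a ∧ par c = t := by simpa using hc
    exact hc'.2 ▸ h.B_subset c hc'.1 hxc

lemma indicator_B_transfer (h : IsCellTree μ par rank a Q B) (t : Γ) :
    (B t).indicator (transfer μ par Q B f) =
      (B t).indicator (fun _ => flux μ par Q B f t) :=
  indicator_congr fun _ hx => transfer_eq h hx

lemma measurable_transfer [Countable Γ] (h : IsCellTree μ par rank a Q B) :
    Measurable (transfer μ par Q B f) := by
  have h1 : Measurable fun x => ∑' t, (B t).indicator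
      (fun _ => ENNReal.ofReal (flux μ par Q B f t)) x :=
    Measurable.tsum fun t => measurable_const.indicator (h.measurable_B t)
  have h2 : Measurable fun x => ∑' t, (B t).indicator
      (fun _ => ENNReal.ofReal (-flux μ par Q B f t)) x :=
    Measurable.tsum fun t => measurable_const.indicator (h.measurable_B t)
  convert h1.ennreal_toReal.sub h2.ennreal_toReal using 1
  ext x
  by_cases hx : ∃ t, x ∈ B t
  · obtain ⟨t, ht⟩ := hx
    rw [transfer_eq h ht]
    simp only [Pi.sub_apply]
    rw [tsum_eq_single t, tsum_eq_single t, indicator_of_mem ht, indicator_of_mem ht,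
      ENNReal.toReal_ofReal', ENNReal.toReal_ofReal', max_zero_sub_max_neg_zero_eq_self]
    all_goals
      intro s hs
      exact indicator_of_notMem (fun hxs => (h.disjoint_B hs).le_bot ⟨hxs, ht⟩) _
  · push Not at hx
    rw [transfer_eq_zero hx]
    simp [hx]

lemma integrable_indicator_B (h : IsCellTree μ par rank a Q B) (t : Γ) (c : ℝ) :
    Integrable ((B t).indicator fun _ => c) μ :=
  (integrable_indicator_iff (h.measurable_B t)).2
    (integrableOn_const (h.measure_B_ne_top t))

lemma integral_flux (h : IsCellTree μ par rank a Q B) {t : Γ} (ht : t ≠ a) :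
    ∫ x, (B t).indicator (fun _ => flux μ par Q B f t) x ∂μ = ∫ x in shadow par Q t, f x ∂μ := by
  rw [integral_indicator (h.measurable_B t), setIntegral_const, flux, smul_eq_mul,
    mul_div_cancel₀]
  exact (ENNReal.toReal_ne_zero).2 ⟨h.measure_B_ne_zero t ht, h.measure_B_ne_top t⟩

lemma shadow_eq (h : IsCellTree μ par rank a Q B) (t : Γ) :
    shadow par Q t = Q t ∪ ⋃ c ∈ (h.finite_children t).toFinset, shadow par Q c := by
  ext x
  simp only [shadow, mem_ofPred_eq, mem_iUnion, exists_prop, Finite.mem_toFinset, mem_union,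
    descends_iff h.par_root h.rank_lt (t := t)]
  constructor
  · rintro ⟨s, rfl | ⟨c, hc, hcs⟩, hx⟩
    · exact Or.inl hx
    · exact Or.inr ⟨c, hc, s, hcs, hx⟩
  · rintro (hx | ⟨c, hc, s, hcs, hx⟩)
    · exact ⟨t, Or.inl rfl, hx⟩
    · exact ⟨s, Or.inr ⟨c, hc, hcs⟩, hx⟩

lemma shadow_root (h : IsCellTree μ par rank a Q B) : shadow par Q a = ⋃ t, Q t := by
  ext x
  simp [shadow, descends_root h.rank_lt]

lemma shadow_subset {X Γ : Type*} {par : Γ → Γ} {Q : Γ → Set X} (t : Γ) : shadow par Q t ⊆ ⋃ t, Q t :=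
  iUnion₂_subset fun s _ => subset_iUnion Q s

lemma integral_shadow [Countable Γ] (h : IsCellTree μ par rank a Q B) (hf : IntegrableOn f (⋃ t, Q t) μ)
    (t : Γ) :
    ∫ x in shadow par Q t, f x ∂μ = ∫ x in Q t, f x ∂μ +
      ∑ c ∈ (h.finite_children t).toFinset, ∫ x in shadow par Q c, f x ∂μ := by
  have hmem : ∀ {s s' : Γ} {x}, x ∈ Q s → x ∈ Q s' → s = s' := fun {s s' x} hs hs' => by
    by_contra hne
    exact (h.disjoint_Q hne).le_bot ⟨hs, hs'⟩
  rw [shadow_eq h t, setIntegral_union, integral_biUnion_finset]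
  · exact fun c _ => measurableSet_shadow h c
  · intro c hc c' hc' hne
    simp only [Finite.coe_toFinset, mem_ofPred_eq] at hc hc'
    rw [Function.onFun, Set.disjoint_left]
    simp only [shadow, mem_iUnion, mem_ofPred_eq, exists_prop]
    rintro x ⟨s, hs, hxs⟩ ⟨s', hs', hxs'⟩
    rw [hmem hxs' hxs] at hs'
    exact hne (hs.child_unique h.par_root h.rank_lt hc hc' hs')
  · exact fun c _ => hf.mono_set (shadow_subset c)
  · rw [Set.disjoint_left]
    simp only [shadow, mem_iUnion, mem_ofPred_eq, exists_prop, Finite.mem_toFinset]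
    rintro x hx ⟨c, hc, s, hs, hxs⟩
    rw [hmem hxs hx] at hs
    exact not_descends_of_par_eq h.par_root h.rank_lt hc.1 hc.2 hs
  · exact Finset.measurableSet_biUnion _ fun c _ => measurableSet_shadow h c
  · exact hf.mono_set (subset_iUnion Q t)
  · exact hf.mono_set (iUnion₂_subset fun c _ => shadow_subset c)

lemma cellPart_eq (h : IsCellTree μ par rank a Q B) (t : Γ) :
    cellPart μ par Q B f t = fun x => ((Q t).indicator f x +
      ∑ c ∈ (h.finite_children t).toFinset, (B c).indicator (fun _ => flux μ par Q B f c) x) -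
        (B t).indicator (fun _ => flux μ par Q B f t) x := by
  ext x
  have h1 := congrFun (indicator_transfer (f := f) h t) x
  have h2 := congrFun (indicator_B_transfer (f := f) h t) x
  rw [cellPart, ← h1, ← h2, ← Pi.add_apply, ← indicator_add']
  rfl

lemma integrable_cellPart (h : IsCellTree μ par rank a Q B)
    (hf : IntegrableOn f (⋃ t, Q t) μ) (t : Γ) : Integrable (cellPart μ par Q B f t) μ := by
  rw [cellPart_eq h]
  refine (Integrable.add ?_ (integrable_finsetSum _ fun c _ => ?_)).sub ?_
  · exact (integrable_indicator_iff (h.measurable_Q t)).2 (hf.mono_set (subset_iUnion Q t))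
  · exact integrable_indicator_B h c _
  · exact integrable_indicator_B h t _

/-- Each part has mean zero: the mass of the shadow of `t` is the mass of its cell plus the masses
received from the children. -/
lemma integral_cellPart [Countable Γ] (h : IsCellTree μ par rank a Q B) (hf : IntegrableOn f (⋃ t, Q t) μ)
    (h0 : ∫ x in ⋃ t, Q t, f x ∂μ = 0) (t : Γ) : ∫ x, cellPart μ par Q B f t x ∂μ = 0 := by
  have hQ : Integrable ((Q t).indicator f) μ :=
    (integrable_indicator_iff (h.measurable_Q t)).2 (hf.mono_set (subset_iUnion Q t))
  have hS : Integrable (fun x => ∑ c ∈ (h.finite_children t).toFinset,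
      (B c).indicator (fun _ => flux μ par Q B f c) x) μ :=
    integrable_finsetSum _ fun c _ => integrable_indicator_B h c _
  rw [cellPart_eq h]
  beta_reduce
  rw [integral_sub (f := fun x => _ + _) (hQ.add hS) (integrable_indicator_B h t _),
    integral_add hQ hS, integral_indicator (h.measurable_Q t),
    integral_finsetSum _ fun c _ => integrable_indicator_B h c _,
    Finset.sum_congr rfl fun c hc => integral_flux h
      (show c ≠ a from ((h.finite_children t).mem_toFinset.1 hc).1),
    ← integral_shadow h hf t, sub_eq_zero]
  by_cases ht : t = a
  · rw [ht, shadow_root h, h0, h.B_root]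
    simp
  · rw [integral_flux h ht]

lemma support_cellPart (t : Γ) : Function.support (cellPart μ par Q B f t) ⊆ Q t ∪ B t := by
  intro x hx
  by_contra hn
  rw [mem_union, not_or] at hn
  exact hx (by rw [cellPart, indicator_of_notMem hn.1, indicator_of_notMem hn.2, sub_zero])

lemma hasSum_cellPart (h : IsCellTree μ par rank a Q B) {x : X} (hx : x ∈ ⋃ t, Q t) :
    HasSum (fun t => cellPart μ par Q B f t x) (f x) := by
  obtain ⟨t, ht⟩ := mem_iUnion.1 hx
  have h1 : HasSum (fun t => (Q t).indicator (fun x => f x + transfer μ par Q B f x) x)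
      (f x + transfer μ par Q B f x) := by
    convert hasSum_single t ?_ using 1
    · rw [indicator_of_mem ht]
    · intro s hs
      exact indicator_of_notMem (fun hxs => (h.disjoint_Q hs).le_bot ⟨hxs, ht⟩) _
  have h2 : HasSum (fun t => (B t).indicator (transfer μ par Q B f) x)
      (transfer μ par Q B f x) := by
    by_cases hb : ∃ t, x ∈ B t
    · obtain ⟨t, ht⟩ := hb
      convert hasSum_single t ?_ using 1
      · rw [indicator_of_mem ht]
      · intro s hs
        exact indicator_of_notMem (fun hxs => (h.disjoint_B hs).le_bot ⟨hxs, ht⟩) _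
    · push Not at hb
      rw [transfer_eq_zero hb]
      convert hasSum_zero with t
      exact indicator_of_notMem (hb t) _
  have h3 := h1.sub h2
  rwa [add_sub_cancel_right] at h3

/-- The weighted `L^q` norms of the parts are controlled by those of `f` and of the masses
transported across the bridges. -/
lemma tsum_lintegral_cellPart_le [Countable Γ] (h : IsCellTree μ par rank a Q B) {q : ℝ} (hq : 1 ≤ q)
    {w : X → ℝ≥0∞} (hw : Measurable w) :
    ∑' t, ∫⁻ x, ‖cellPart μ par Q B f t x‖ₑ ^ q * w x ∂μ ≤
      2 ^ (q - 1) * ∫⁻ x in ⋃ t, Q t, ‖f x‖ₑ ^ q * w x ∂μ +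
        (2 ^ (q - 1) + 1) * ∑' t, ‖flux μ par Q B f t‖ₑ ^ q * ∫⁻ x in B t, w x ∂μ := by
  have hq0 : 0 < q := by linarith
  set G := transfer μ par Q B f with hG
  have hGm : Measurable fun x => ‖G x‖ₑ ^ q * w x :=
    ((measurable_transfer h).enorm.pow_const q).mul hw
  have hpt : ∀ t x, ‖cellPart μ par Q B f t x‖ₑ ^ q * w x ≤
      (Q t).indicator (fun x => 2 ^ (q - 1) * (‖f x‖ₑ ^ q * w x) +
        2 ^ (q - 1) * (‖G x‖ₑ ^ q * w x)) x + (B t).indicator (fun x => ‖G x‖ₑ ^ q * w x) x := by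
    intro t x
    by_cases hx : x ∈ Q t
    · have hxB : x ∉ B t := Set.disjoint_left.1 (disjoint_Q_B h t) hx
      rw [cellPart, indicator_of_mem hx, indicator_of_mem hx, indicator_of_notMem hxB,
        indicator_of_notMem hxB, sub_zero, add_zero, ← mul_add, ← add_mul, ← mul_assoc]
      gcongr
      calc ‖f x + G x‖ₑ ^ q ≤ (‖f x‖ₑ + ‖G x‖ₑ) ^ q := by
            gcongr
            exact enorm_add_le _ _
        _ ≤ _ := ENNReal.rpow_add_le_mul_rpow_add_rpow _ _ hq
    · by_cases hxB : x ∈ B t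
      · rw [cellPart, indicator_of_notMem hx, indicator_of_notMem hx, indicator_of_mem hxB,
          indicator_of_mem hxB, zero_sub, zero_add, enorm_neg]
      · rw [cellPart, indicator_of_notMem hx, indicator_of_notMem hx, indicator_of_notMem hxB,
          indicator_of_notMem hxB]
        simp [hq0]
  have hBsum : ∑' t, ∫⁻ x in B t, ‖G x‖ₑ ^ q * w x ∂μ =
      ∑' t, ‖flux μ par Q B f t‖ₑ ^ q * ∫⁻ x in B t, w x ∂μ := by
    refine tsum_congr fun t => ?_
    rw [← lintegral_const_mul _ hw]
    refine setLIntegral_congr_fun (h.measurable_B t) fun x hx => ?_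
    simp only [hG, transfer_eq h hx]
  have hQG : ∫⁻ x in ⋃ t, Q t, ‖G x‖ₑ ^ q * w x ∂μ ≤
      ∑' t, ‖flux μ par Q B f t‖ₑ ^ q * ∫⁻ x in B t, w x ∂μ := by
    rw [← hBsum, ← lintegral_iUnion h.measurable_B h.disjoint_B,
      ← lintegral_indicator (.iUnion h.measurable_Q), ← lintegral_indicator (.iUnion h.measurable_B)]
    refine lintegral_mono fun x => ?_
    by_cases hx : x ∈ ⋃ t, B t
    · rw [indicator_of_mem hx]
      exact indicator_le_self _ _ _
    · have hx' : ∀ t, x ∉ B t := by simpa using hx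
      have : G x = 0 := transfer_eq_zero hx'
      by_cases hxQ : x ∈ ⋃ t, Q t
      · rw [indicator_of_mem hxQ, this]
        simp [hq0]
      · rw [indicator_of_notMem hxQ]
        exact zero_le
  calc _ ≤ ∑' t, (∫⁻ x in Q t, (2 ^ (q - 1) * (‖f x‖ₑ ^ q * w x) +
        2 ^ (q - 1) * (‖G x‖ₑ ^ q * w x)) ∂μ + ∫⁻ x in B t, ‖G x‖ₑ ^ q * w x ∂μ) := by
        refine ENNReal.tsum_le_tsum fun t => (lintegral_mono (hpt t)).trans_eq ?_
        rw [lintegral_add_right _ (hGm.indicator (h.measurable_B t)),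
          lintegral_indicator (h.measurable_Q t), lintegral_indicator (h.measurable_B t)]
    _ = ∫⁻ x in ⋃ t, Q t, (2 ^ (q - 1) * (‖f x‖ₑ ^ q * w x) +
        2 ^ (q - 1) * (‖G x‖ₑ ^ q * w x)) ∂μ +
        ∑' t, ‖flux μ par Q B f t‖ₑ ^ q * ∫⁻ x in B t, w x ∂μ := by
        rw [ENNReal.tsum_add, hBsum, lintegral_iUnion h.measurable_Q h.disjoint_Q]
    _ ≤ _ := by
        have hc : (2 : ℝ≥0∞) ^ (q - 1) ≠ ∞ := ENNReal.rpow_ne_top_of_nonneg (by linarith) (by simp)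
        rw [lintegral_add_right _ (hGm.const_mul _), lintegral_const_mul' _ _ hc,
          lintegral_const_mul' _ _ hc, add_mul, one_mul, add_assoc]
        gcongr

end CellTree

/-! ### A weighted discrete Hardy inequality -/

/-- Schur's test, for a nonnegative kernel and an auxiliary weight `b`. -/
lemma tsum_rpow_le_of_schur {Γ : Type*} {p q : ℝ} (hpq : p.HolderConjugate q)
    (κ : Γ → Γ → ℝ≥0∞) (w v b D : Γ → ℝ≥0∞) (hb : ∀ s, b s ≠ 0) (hb' : ∀ s, b s ≠ ∞)
    (hD : ∀ t, ∑' s, κ t s * b s ^ p ≤ D t)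
    (hv : ∀ s, ∑' t, w t * D t ^ (q - 1) * κ t s ≤ v s * b s ^ q) (A : Γ → ℝ≥0∞) :
    ∑' t, w t * (∑' s, κ t s * A s) ^ q ≤ ∑' s, v s * A s ^ q := by
  have hp : 0 < p := hpq.pos
  have hq : 0 < q := hpq.symm.pos
  have hsum : q⁻¹ + p⁻¹ = 1 := hpq.symm.inv_add_inv_eq_one
  let _ : MeasurableSpace Γ := ⊤
  have holder : ∀ t, (∑' s, κ t s * A s) ^ q ≤
      D t ^ (q - 1) * ∑' s, κ t s * (A s / b s) ^ q := by
    intro t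
    have h1 := ENNReal.lintegral_mul_le_Lp_mul_Lq (Measure.count (α := Γ)) hpq.symm
      (f := fun s => κ t s ^ q⁻¹ * (A s / b s)) (g := fun s => κ t s ^ p⁻¹ * b s)
      measurable_from_top.aemeasurable measurable_from_top.aemeasurable
    simp only [lintegral_count, Pi.mul_apply] at h1
    have e1 : ∀ s, κ t s ^ q⁻¹ * (A s / b s) * (κ t s ^ p⁻¹ * b s) = κ t s * A s := fun s => by
      rw [mul_mul_mul_comm, ENNReal.div_mul_cancel (hb s) (hb' s),
        ← ENNReal.rpow_add_of_nonneg _ _ (by positivity) (by positivity), hsum, ENNReal.rpow_one]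
    have e2 : ∀ s, (κ t s ^ q⁻¹ * (A s / b s)) ^ q = κ t s * (A s / b s) ^ q := fun s => by
      rw [ENNReal.mul_rpow_of_nonneg _ _ hq.le, ← ENNReal.rpow_mul, inv_mul_cancel₀ hq.ne',
        ENNReal.rpow_one]
    have e3 : ∀ s, (κ t s ^ p⁻¹ * b s) ^ p = κ t s * b s ^ p := fun s => by
      rw [ENNReal.mul_rpow_of_nonneg _ _ hp.le, ← ENNReal.rpow_mul, inv_mul_cancel₀ hp.ne',
        ENNReal.rpow_one]
    simp only [e1, e2, e3, one_div] at h1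
    calc (∑' s, κ t s * A s) ^ q
        ≤ ((∑' s, κ t s * (A s / b s) ^ q) ^ q⁻¹ * (∑' s, κ t s * b s ^ p) ^ p⁻¹) ^ q := by
          gcongr
      _ = (∑' s, κ t s * (A s / b s) ^ q) * (∑' s, κ t s * b s ^ p) ^ (q - 1) := by
          rw [ENNReal.mul_rpow_of_nonneg _ _ hq.le, ← ENNReal.rpow_mul, ← ENNReal.rpow_mul,
            inv_mul_cancel₀ hq.ne', ENNReal.rpow_one, ← hpq.symm.div_conj_eq_sub_one,
            inv_mul_eq_div]
      _ ≤ (∑' s, κ t s * (A s / b s) ^ q) * D t ^ (q - 1) := by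
          gcongr
          · exact hpq.symm.sub_one_pos.le
          · exact hD t
      _ = _ := mul_comm _ _
  calc ∑' t, w t * (∑' s, κ t s * A s) ^ q
      ≤ ∑' t, ∑' s, w t * D t ^ (q - 1) * κ t s * (A s / b s) ^ q := by
        refine ENNReal.tsum_le_tsum fun t => ?_
        rw [← ENNReal.tsum_mul_left.symm.trans (tsum_congr fun s => (mul_assoc _ _ _).symm),
          mul_assoc]
        gcongr
        exact holder t
    _ = ∑' s, (∑' t, w t * D t ^ (q - 1) * κ t s) * (A s / b s) ^ q := by
        rw [ENNReal.tsum_comm]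
        exact tsum_congr fun s => ENNReal.tsum_mul_right
    _ ≤ ∑' s, v s * A s ^ q := by
        refine ENNReal.tsum_le_tsum fun s => ?_
        calc _ ≤ v s * b s ^ q * (A s / b s) ^ q := by
              gcongr
              exact hv s
          _ = v s * A s ^ q := by
              rw [mul_assoc, ← ENNReal.mul_rpow_of_nonneg _ _ hq.le,
                ENNReal.mul_div_cancel (hb s) (hb' s)]

/-- The number `2^{-θk}`. -/
noncomputable def decay (θ : ℝ) (k : ℕ) : ℝ≥0∞ := (2 : ℝ≥0∞) ^ (-(θ * k))

lemma decay_eq_ofReal (θ : ℝ) (k : ℕ) :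
    decay θ k = ENNReal.ofReal (((2 : ℝ) ^ k) ^ (-θ)) := by
  rw [decay, ← ENNReal.ofReal_rpow_of_pos (by positivity), ENNReal.ofReal_pow (by norm_num),
    ENNReal.ofReal_ofNat, ← ENNReal.rpow_natCast, ← ENNReal.rpow_mul]
  ring_nf

lemma decay_le_one {θ : ℝ} (hθ : 0 ≤ θ) (k : ℕ) : decay θ k ≤ 1 := by
  rw [decay_eq_ofReal, ENNReal.ofReal_le_one]
  exact Real.rpow_le_one_of_one_le_of_nonpos (one_le_pow₀ (by norm_num)) (by linarith)

lemma decay_ne_zero (θ : ℝ) (k : ℕ) : decay θ k ≠ 0 :=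
  (ENNReal.rpow_pos (by simp) (by simp)).ne'

lemma decay_ne_top (θ : ℝ) (k : ℕ) : decay θ k ≠ ∞ :=
  ENNReal.rpow_ne_top_of_ne_zero (by simp) (by simp)

lemma decay_mul (θ θ' : ℝ) (k : ℕ) : decay θ k * decay θ' k = decay (θ + θ') k := by
  rw [decay, decay, decay, ← ENNReal.rpow_add _ _ (by simp) (by simp)]
  ring_nf

lemma decay_add (θ : ℝ) (k r : ℕ) : decay θ (k + r) = decay θ k * decay θ r := by
  rw [decay, decay, decay, ← ENNReal.rpow_add _ _ (by simp) (by simp)]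
  push_cast
  ring_nf

lemma decay_rpow (θ r : ℝ) (k : ℕ) : decay θ k ^ r = decay (θ * r) k := by
  rw [decay, decay, ← ENNReal.rpow_mul]
  ring_nf

lemma decay_neg_natCast (m r : ℕ) : decay (-m) r = ((2 ^ r) ^ m : ℕ) := by
  rw [decay, ← pow_mul, neg_mul, neg_neg, mul_comm, ← Nat.cast_mul, ENNReal.rpow_natCast]
  push_cast
  rfl

lemma tsum_decay_ne_top {δ : ℝ} (hδ : 0 < δ) : ∑' r, decay δ r ≠ ∞ := by
  have h1 : ∀ r, decay δ r = ((2 : ℝ≥0∞) ^ (-δ)) ^ r := fun r => by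
    rw [decay, ← ENNReal.rpow_natCast, ← ENNReal.rpow_mul, neg_mul]
  have h2 : (2 : ℝ≥0∞) ^ (-δ) < 1 :=
    ENNReal.rpow_lt_one_of_one_lt_of_neg (by simp) (by linarith)
  simp_rw [h1]
  rw [ENNReal.tsum_geometric]
  exact ENNReal.inv_ne_top.2 (tsub_pos_of_lt h2).ne'

section Counting

open scoped Classical in
/-- The indicator of a proposition. -/
noncomputable def ind (P : Prop) : ℝ≥0∞ := if P then 1 else 0

lemma ind_of {P : Prop} (h : P) : ind P = 1 := if_pos h

lemma ind_of_not {P : Prop} (h : ¬ P) : ind P = 0 := if_neg h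

lemma ind_mono {P P' : Prop} (h : P → P') : ind P ≤ ind P' := by
  by_cases hP : P
  · rw [ind_of hP, ind_of (h hP)]
  · rw [ind_of_not hP]
    exact zero_le

variable {Γ : Type*} {m : ℕ} {gen : Γ → ℕ} {hor : Γ → Fin m → ℕ} {R : Γ → Γ → Prop} {α : ℝ}
  {M : ℝ≥0∞}

/-- The weights of the descendants of `t`: there are at most `2^{rm} M 2^{(1-α)k}` of them in
generation `k = gen t + r`. -/
lemma tsum_descendants_le
    (hcol : ∀ k j, ∑' s, ind (gen s = k ∧ hor s = j) ≤ M * decay (α - 1) k)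
    (hR : ∀ t s, R t s → gen t ≤ gen s ∧ ∀ i, hor s i / 2 ^ (gen s - gen t) = hor t i)
    {τ δ : ℝ} (hδ : τ + α - 1 = δ + m) (t : Γ) :
    ∑' s, ind (R t s) * decay τ (gen s) ≤
      M * (∑' r, decay δ r) * decay (τ + α - 1) (gen t) := by
  have hcount : ∀ r, ∑' s, ind (R t s ∧ gen s = gen t + r) ≤
      decay (-m) r * (M * decay (α - 1) (gen t + r)) := by
    intro r
    set P : Finset (Fin m → ℕ) :=
      Fintype.piFinset fun i => Finset.Ico (hor t i * 2 ^ r) ((hor t i + 1) * 2 ^ r) with hP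
    have hcard : P.card = (2 ^ r) ^ m := by
      rw [hP, Fintype.card_piFinset]
      simp [Nat.card_Ico, ← Nat.sub_mul]
    calc ∑' s, ind (R t s ∧ gen s = gen t + r)
        ≤ ∑' s, ∑ j ∈ P, ind (gen s = gen t + r ∧ hor s = j) := by
          refine ENNReal.tsum_le_tsum fun s => ?_
          by_cases h : R t s ∧ gen s = gen t + r
          · have hmem : hor s ∈ P := by
              rw [hP, Fintype.mem_piFinset]
              intro i
              have h1 := (hR t s h.1).2 i
              rw [h.2, Nat.add_sub_cancel_left, Nat.div_eq_iff (by positivity)] at h1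
              rw [Finset.mem_Ico, Nat.add_mul]
              have : 0 < 2 ^ r := by positivity
              omega
            refine le_trans (ind_mono ?_) (Finset.single_le_sum
              (f := fun j => ind (gen s = gen t + r ∧ hor s = j)) (fun _ _ => zero_le) hmem)
            exact fun h => ⟨h.2, rfl⟩
          · rw [ind_of_not h]
            exact zero_le
      _ = ∑ j ∈ P, ∑' s, ind (gen s = gen t + r ∧ hor s = j) :=
          Summable.tsum_finsetSum fun _ _ => ENNReal.summable
      _ ≤ ∑ _j ∈ P, M * decay (α - 1) (gen t + r) := Finset.sum_le_sum fun j _ => hcol _ j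
      _ = _ := by rw [Finset.sum_const, hcard, decay_neg_natCast, nsmul_eq_mul]
  calc ∑' s, ind (R t s) * decay τ (gen s)
      ≤ ∑' s, ∑' r, ind (R t s ∧ gen s = gen t + r) * decay τ (gen t + r) := by
        refine ENNReal.tsum_le_tsum fun s => ?_
        by_cases h : R t s
        · have hg : gen s = gen t + (gen s - gen t) := by
            have := (hR t s h).1
            omega
          refine le_trans ?_ (ENNReal.le_tsum (gen s - gen t))
          rw [ind_of h, ind_of ⟨h, hg⟩, ← hg]
        · rw [ind_of_not h, zero_mul]
          exact zero_le
    _ = ∑' r, (∑' s, ind (R t s ∧ gen s = gen t + r)) * decay τ (gen t + r) := by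
        rw [ENNReal.tsum_comm]
        exact tsum_congr fun r => ENNReal.tsum_mul_right
    _ ≤ ∑' r, M * decay (τ + α - 1) (gen t) * decay δ r := by
        refine ENNReal.tsum_le_tsum fun r => ?_
        calc _ ≤ decay (-m) r * (M * decay (α - 1) (gen t + r)) * decay τ (gen t + r) := by
              gcongr
              exact hcount r
          _ = M * (decay (-m) r * decay (τ + α - 1) (gen t + r)) := by
              rw [show τ + α - 1 = (α - 1) + τ by ring, ← decay_mul]
              ring
          _ = _ := by
              rw [decay_add, hδ, ← decay_mul δ m r]
              have : decay (-m) r * decay m r = 1 := by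
                rw [decay_mul, neg_add_cancel, decay]
                simp
              calc _ = M * decay (δ + m) (gen t) * decay δ r * (decay (-m) r * decay m r) := by ring
                _ = _ := by rw [this, mul_one]
    _ = _ := by
        rw [ENNReal.tsum_mul_left]
        ring

/-- The weights of the ancestors of `s`: there are at most `M 2^{(1-α)k}` of them in generation
`k ≤ gen s`, all in one column. -/
lemma tsum_ancestors_le
    (hcol : ∀ k j, ∑' s, ind (gen s = k ∧ hor s = j) ≤ M * decay (α - 1) k)
    (hR : ∀ t s, R t s → gen t ≤ gen s ∧ ∀ i, hor s i / 2 ^ (gen s - gen t) = hor t i)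
    {σ γ : ℝ} (hγ : σ + α - 1 = -γ) (s : Γ) :
    ∑' t, decay σ (gen t) * ind (R t s) ≤
      M * (∑' r, decay γ r) * decay (σ + α - 1) (gen s) := by
  calc ∑' t, decay σ (gen t) * ind (R t s)
      ≤ ∑' t, ∑' r, ind (R t s ∧ gen t + r = gen s) * decay σ (gen s - r) := by
        refine ENNReal.tsum_le_tsum fun t => ?_
        by_cases h : R t s
        · have h1 := (hR t s h).1
          refine le_trans ?_ (ENNReal.le_tsum (gen s - gen t))
          rw [ind_of h, ind_of ⟨h, by omega⟩, mul_one, one_mul,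
            show gen s - (gen s - gen t) = gen t by omega]
        · rw [ind_of_not h, mul_zero]
          exact zero_le
    _ = ∑' r, (∑' t, ind (R t s ∧ gen t + r = gen s)) * decay σ (gen s - r) := by
        rw [ENNReal.tsum_comm]
        exact tsum_congr fun r => ENNReal.tsum_mul_right
    _ ≤ ∑' r, M * decay (σ + α - 1) (gen s) * decay γ r := by
        refine ENNReal.tsum_le_tsum fun r => ?_
        by_cases hr : r ≤ gen s
        · have hc : ∑' t, ind (R t s ∧ gen t + r = gen s) ≤ M * decay (α - 1) (gen s - r) := by
            refine le_trans (ENNReal.tsum_le_tsum fun t => ind_mono fun h => ?_)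
              (hcol (gen s - r) fun i => hor s i / 2 ^ r)
            refine ⟨by omega, funext fun i => ?_⟩
            rw [← (hR t s h.1).2 i, show gen s - gen t = r by omega]
          calc _ ≤ M * decay (α - 1) (gen s - r) * decay σ (gen s - r) := by gcongr
            _ = M * decay (σ + α - 1) (gen s - r) := by
                rw [mul_assoc, decay_mul]
                ring_nf
            _ = M * decay (σ + α - 1) (gen s) * decay γ r := by
                conv_rhs => rw [← Nat.sub_add_cancel hr, decay_add]
                have : decay (σ + α - 1) r * decay γ r = 1 := by
                  rw [decay_mul, hγ, neg_add_cancel, decay]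
                  simp
                rw [mul_assoc, mul_assoc, this, mul_one]
        · have : ∑' t, ind (R t s ∧ gen t + r = gen s) = 0 := by
            rw [ENNReal.tsum_eq_zero]
            exact fun t => ind_of_not (by omega)
          rw [this, zero_mul]
          exact zero_le
    _ = _ := by
        rw [ENNReal.tsum_mul_left]
        ring

/-- The weighted Hardy inequality on the tree. The auxiliary weight in Schur's test is
`2^{-k τ / p}`; the sums over descendants and over ancestors both converge when
`m + 1 - α < τ < m + 1 + β p`, and `τ` is the midpoint of this interval. -/
theorem discrete_hardy
    (hM : M ≠ ∞) (hcol : ∀ k j, ∑' s, ind (gen s = k ∧ hor s = j) ≤ M * decay (α - 1) k)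
    (hR : ∀ t s, R t s → gen t ≤ gen s ∧ ∀ i, hor s i / 2 ^ (gen s - gen t) = hor t i)
    {p q β : ℝ} (hpq : p.HolderConjugate q) (hβ : -α < β * p) :
    ∃ C : ℝ≥0∞, C ≠ ∞ ∧ ∀ A : Γ → ℝ≥0∞,
      ∑' t, decay ((m + 1) * (1 - q) - (β + α - 1) * q) (gen t) *
        (∑' s, ind (R t s) * A s) ^ q ≤
      C * ∑' s, decay ((m + 1) * (1 - q) - β * q) (gen s) * A s ^ q := by
  have hp : 0 < p := hpq.pos
  have hq1 : 0 < q - 1 := hpq.symm.sub_one_pos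
  have hqp : q / p = q - 1 := hpq.symm.div_conj_eq_sub_one
  have hq : q = p * (q - 1) := by
    rw [← hqp]
    field_simp
  set τ : ℝ := m + 1 + (β * p - α) / 2 with hτ
  set δ : ℝ := (β * p + α) / 2 with hδ
  have hδ0 : 0 < δ := by rw [hδ]; linarith
  set γ : ℝ := (q - 1) * δ with hγ
  have hγ0 : 0 < γ := mul_pos hq1 hδ0
  set w : ℝ := (m + 1) * (1 - q) - (β + α - 1) * q with hw
  set v : ℝ := (m + 1) * (1 - q) - β * q with hv
  set C₁ : ℝ≥0∞ := M * ∑' r, decay δ r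
  set C₂ : ℝ≥0∞ := M * ∑' r, decay γ r
  have hC₁t : C₁ ≠ ∞ := ENNReal.mul_ne_top hM (tsum_decay_ne_top hδ0)
  have hC₂t : C₂ ≠ ∞ := ENNReal.mul_ne_top hM (tsum_decay_ne_top hγ0)
  set σ : ℝ := w + (τ + α - 1) * (q - 1) with hσ
  have hσv : σ + α - 1 = v + τ / p * q := by
    rw [div_mul_eq_mul_div, mul_div_assoc, hqp, hσ, hw, hv]
    ring
  have hσγ : σ + α - 1 = -γ := by
    rw [hσv, div_mul_eq_mul_div, mul_div_assoc, hqp, hv, hγ, hδ, hτ]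
    linear_combination -β * hq
  refine ⟨C₁ ^ (q - 1) * C₂,
    ENNReal.mul_ne_top (ENNReal.rpow_ne_top_of_nonneg hq1.le hC₁t) hC₂t, fun A => ?_⟩
  rw [← ENNReal.tsum_mul_left]
  simp_rw [← mul_assoc]
  refine tsum_rpow_le_of_schur hpq (fun t s => ind (R t s)) _ _
    (fun s => decay (τ / p) (gen s)) (fun t => C₁ * decay (τ + α - 1) (gen t))
    (fun _ => decay_ne_zero _ _) (fun _ => decay_ne_top _ _) (fun t => ?_) (fun s => ?_) A
  · simp_rw [decay_rpow, div_mul_cancel₀ τ hp.ne']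
    exact tsum_descendants_le hcol hR (by rw [hτ, hδ]; ring) t
  · calc _ = ∑' t, C₁ ^ (q - 1) * (decay σ (gen t) * ind (R t s)) := by
          refine tsum_congr fun t => ?_
          rw [ENNReal.mul_rpow_of_nonneg _ _ hq1.le, decay_rpow, hσ, ← decay_mul]
          ring
      _ = C₁ ^ (q - 1) * ∑' t, decay σ (gen t) * ind (R t s) := ENNReal.tsum_mul_left
      _ ≤ C₁ ^ (q - 1) * (C₂ * decay (σ + α - 1) (gen s)) := by
          gcongr
          exact tsum_ancestors_le hcol hR hσγ s
      _ = _ := by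
          rw [decay_rpow, hσv, ← decay_mul]
          ring

end Counting

/-! ### Dyadic cells -/

/-- The edge of the dyadic cells of generation `k`. -/
noncomputable def edge (ℓ : ℝ) (k : ℕ) : ℝ := ℓ / 2 ^ k

/-- The shift that moves the lowest corner of the root cube `(-ℓ/2, ℓ/2)^m × (0, ℓ)` to the
origin. -/
noncomputable def shift (m : ℕ) (ℓ : ℝ) (i : Fin (m + 1)) : ℝ := if i = Fin.last m then 0 else ℓ / 2

/-- The lowest corner of the dyadic cell of generation `k` with index `J`. -/
noncomputable def corner {m : ℕ} (ℓ : ℝ) (k : ℕ) (J : Fin (m + 1) → ℕ) : Eucl (m + 1) :=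
  WithLp.toLp 2 fun i => J i * edge ℓ k - shift m ℓ i

/-- The open dyadic cell of generation `k` with index `J`. -/
noncomputable def cell {m : ℕ} (ℓ : ℝ) (k : ℕ) (J : Fin (m + 1) → ℕ) : Set (Eucl (m + 1)) :=
  box (corner ℓ k J) (edge ℓ k) 0 (edge ℓ k)

/-- The cell with index `J` and height `h` satisfies `h + 2 e ≤ φ` over the cube three times as
large as its base, where `e` is its edge. -/
def IsGood {m : ℕ} (ℓ : ℝ) (φ : Eucl m → ℝ) (k : ℕ) (J : Fin (m + 1) → ℕ) : Prop :=
  ∀ y : Eucl m, (∀ i : Fin m, J i.castSucc * edge ℓ k - edge ℓ k < y i + ℓ / 2 ∧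
    y i + ℓ / 2 < J i.castSucc * edge ℓ k + 2 * edge ℓ k) →
    J (Fin.last m) * edge ℓ k + 2 * edge ℓ k ≤ φ y

/-- The index, `r` generations earlier, of the dyadic cell that contains the cell with
index `J`. -/
def ancestor {m : ℕ} (r : ℕ) (J : Fin (m + 1) → ℕ) : Fin (m + 1) → ℕ := fun i => J i / 2 ^ r

/-- The index of the cell directly below the cell with index `J`. -/
def below {m : ℕ} (J : Fin (m + 1) → ℕ) : Fin (m + 1) → ℕ :=
  Function.update J (Fin.last m) (J (Fin.last m) - 1)

/-- The maximal good dyadic cells with base in `(-ℓ/2, ℓ/2)^m`. -/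
structure IsWhitney {m : ℕ} (ℓ : ℝ) (φ : Eucl m → ℝ) (k : ℕ) (J : Fin (m + 1) → ℕ) : Prop where
  lt_pow : ∀ i : Fin m, J i.castSucc < 2 ^ k
  good : IsGood ℓ φ k J
  maximal : ∀ k' < k, ¬ IsGood ℓ φ k' (ancestor (k - k') J)

section Dyadic

variable {m : ℕ} {ℓ : ℝ} {φ : Eucl m → ℝ} {k k' : ℕ} {J J' : Fin (m + 1) → ℕ}

lemma edge_pos (hℓ : 0 < ℓ) (k : ℕ) : 0 < edge ℓ k := by
  rw [edge]; positivity

lemma edge_zero : edge ℓ 0 = ℓ := by simp [edge]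

lemma two_pow_mul_edge (k : ℕ) : 2 ^ k * edge ℓ k = ℓ := by
  rw [edge]; field_simp

lemma edge_sub (h : k' ≤ k) : edge ℓ k' = 2 ^ (k - k') * edge ℓ k := by
  obtain ⟨r, rfl⟩ := Nat.exists_eq_add_of_le h
  rw [edge, edge, Nat.add_sub_cancel_left, pow_add]
  field_simp

lemma edge_le (hℓ : 0 < ℓ) (h : k' ≤ k) : edge ℓ k ≤ edge ℓ k' := by
  rw [edge_sub h]
  exact le_mul_of_one_le_left (edge_pos hℓ k).le (one_le_pow₀ (by norm_num))

@[simp] lemma shift_castSucc (i : Fin m) : shift m ℓ i.castSucc = ℓ / 2 := by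
  rw [shift, if_neg (Fin.castSucc_lt_last i).ne]

@[simp] lemma shift_last : shift m ℓ (Fin.last m) = 0 := by
  rw [shift, if_pos rfl]

lemma corner_apply (i : Fin (m + 1)) : corner ℓ k J i = J i * edge ℓ k - shift m ℓ i := rfl

lemma vert_corner : vert (corner ℓ k J) = J (Fin.last m) * edge ℓ k := by
  rw [vert, corner_apply, shift_last, sub_zero]

lemma mem_cell {x : Eucl (m + 1)} : x ∈ cell ℓ k J ↔ ∀ i, J i * edge ℓ k < x i + shift m ℓ i ∧
    x i + shift m ℓ i < (J i + 1) * edge ℓ k := by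
  rw [Fin.forall_fin_succ']
  refine and_congr (forall_congr' fun i => ?_) ?_
  · rw [corner_apply]
    constructor <;> rintro ⟨h1, h2⟩ <;> constructor <;> linarith
  · rw [vert_corner, vert, shift_last]
    constructor <;> rintro ⟨h1, h2⟩ <;> constructor <;> linarith

@[simp] lemma below_castSucc (i : Fin m) : below J i.castSucc = J i.castSucc :=
  Function.update_of_ne (Fin.castSucc_lt_last i).ne _ _

@[simp] lemma below_last : below J (Fin.last m) = J (Fin.last m) - 1 :=
  Function.update_self _ _ _

lemma ancestor_ancestor (r r' : ℕ) : ancestor r' (ancestor r J) = ancestor (r + r') J := by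
  ext i
  simp only [ancestor]
  rw [Nat.div_div_eq_div_mul, pow_add]

lemma ancestor_zero : ancestor 0 J = J := by
  ext i
  simp [ancestor]

/-- A cell lies inside its ancestors. -/
lemma ancestor_bounds (hℓ : 0 < ℓ) (h : k' ≤ k) (i : Fin (m + 1)) :
    ancestor (k - k') J i * edge ℓ k' ≤ J i * edge ℓ k ∧
      (J i + 1) * edge ℓ k ≤ (ancestor (k - k') J i + 1) * edge ℓ k' := by
  have he := edge_pos hℓ k
  have h1 : ancestor (k - k') J i * 2 ^ (k - k') ≤ J i := Nat.div_mul_le_self _ _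
  have h2 : J i + 1 ≤ (ancestor (k - k') J i + 1) * 2 ^ (k - k') :=
    Nat.lt_mul_of_div_lt (Nat.lt_succ_self _) (by positivity)
  have h1' : (ancestor (k - k') J i : ℝ) * 2 ^ (k - k') ≤ J i := mod_cast h1
  have h2' : (J i : ℝ) + 1 ≤ (ancestor (k - k') J i + 1) * 2 ^ (k - k') := mod_cast h2
  rw [edge_sub h, ← mul_assoc, ← mul_assoc]
  exact ⟨by gcongr, by gcongr⟩

lemma cell_subset_ancestor (hℓ : 0 < ℓ) (h : k' ≤ k) :
    cell ℓ k J ⊆ cell ℓ k' (ancestor (k - k') J) := by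
  intro x hx
  rw [mem_cell] at hx ⊢
  intro i
  have h1 := hx i
  have h2 := ancestor_bounds (J := J) hℓ h i
  exact ⟨h2.1.trans_lt h1.1, h1.2.trans_le h2.2⟩

/-- A cell meeting a cell of an earlier generation descends from it. -/
lemma ancestor_eq_of_mem (hℓ : 0 < ℓ) (h : k' ≤ k) {x : Eucl (m + 1)} (hx : x ∈ cell ℓ k J)
    (hx' : x ∈ cell ℓ k' J') : ancestor (k - k') J = J' := by
  ext i
  rw [mem_cell] at hx hx'
  have h1 := hx i
  have h2 := hx' i
  have he := edge_pos hℓ k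
  rw [edge_sub h, ← mul_assoc, ← mul_assoc] at h2
  have h3 : (J' i : ℝ) * 2 ^ (k - k') < J i + 1 :=
    lt_of_mul_lt_mul_right (h2.1.trans h1.2) he.le
  have h4 : (J i : ℝ) < (J' i + 1) * 2 ^ (k - k') :=
    lt_of_mul_lt_mul_right (h1.1.trans h2.2) he.le
  have h3' : J' i * 2 ^ (k - k') < J i + 1 := mod_cast h3
  have h4' : J i < (J' i + 1) * 2 ^ (k - k') := mod_cast h4
  exact Nat.div_eq_of_lt_le (by omega) h4'

/-- Goodness passes to lower cells. -/
lemma IsGood.of_le (hℓ : 0 < ℓ) (hg : IsGood ℓ φ k J)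
    (h : ∀ i : Fin m, J' i.castSucc = J i.castSucc) (hl : J' (Fin.last m) ≤ J (Fin.last m)) :
    IsGood ℓ φ k J' := by
  intro y hy
  refine le_trans ?_ (hg y fun i => h i ▸ hy i)
  have he := edge_pos hℓ k
  gcongr

/-- Every good cell lies in a maximal one. -/
lemma exists_isWhitney (hJ : ∀ i : Fin m, J i.castSucc < 2 ^ k) (hg : IsGood ℓ φ k J) :
    ∃ k' ≤ k, IsWhitney ℓ φ k' (ancestor (k - k') J) := by
  classical
  have hex : ∃ k', k' ≤ k ∧ IsGood ℓ φ k' (ancestor (k - k') J) :=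
    ⟨k, le_rfl, by rwa [Nat.sub_self, ancestor_zero]⟩
  obtain ⟨hle, hgood⟩ := Nat.find_spec hex
  refine ⟨Nat.find hex, hle, fun i => ?_, hgood, fun k' hk' hg' => ?_⟩
  · rw [ancestor, Nat.div_lt_iff_lt_mul (by positivity), ← pow_add, Nat.add_sub_cancel' hle]
    exact hJ i
  · refine Nat.find_min hex hk' ⟨by omega, ?_⟩
    rwa [ancestor_ancestor, show k - Nat.find hex + (Nat.find hex - k') = k - k' by omega] at hg'

/-- Two maximal good cells that meet are equal. -/
lemma IsWhitney.eq_of_mem (hℓ : 0 < ℓ) (h : IsWhitney ℓ φ k J) (h' : IsWhitney ℓ φ k' J')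
    {x : Eucl (m + 1)} (hx : x ∈ cell ℓ k J) (hx' : x ∈ cell ℓ k' J') : k = k' ∧ J = J' := by
  wlog hk : k' ≤ k generalizing k k' J J'
  · have := this h' h hx' hx (by omega)
    exact ⟨this.1.symm, this.2.symm⟩
  have ha := ancestor_eq_of_mem hℓ hk hx hx'
  rcases hk.eq_or_lt with rfl | hlt
  · rw [Nat.sub_self, ancestor_zero] at ha
    exact ⟨rfl, ha⟩
  · exact absurd (ha ▸ h'.good) (h.maximal k' hlt)

/-- The cell of generation `k` with index `J`, extended downward by half its edge. -/
noncomputable def extendedCell (ℓ : ℝ) (k : ℕ) (J : Fin (m + 1) → ℕ) : Set (Eucl (m + 1)) :=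
  box (corner ℓ k J) (edge ℓ k) (-(edge ℓ k / 2)) (edge ℓ k)

/-- The part added to a cell by extending it downward. -/
noncomputable def bridge (ℓ : ℝ) (k : ℕ) (J : Fin (m + 1) → ℕ) : Set (Eucl (m + 1)) :=
  box (corner ℓ k J) (edge ℓ k) (-(edge ℓ k / 2)) 0

lemma cell_subset_extendedCell (hℓ : 0 < ℓ) : cell ℓ k J ⊆ extendedCell ℓ k J := by
  have he := edge_pos hℓ k
  exact fun x hx => ⟨hx.1, by linarith [hx.2.1], hx.2.2⟩

lemma bridge_subset_extendedCell (hℓ : 0 < ℓ) : bridge ℓ k J ⊆ extendedCell ℓ k J := by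
  have he := edge_pos hℓ k
  exact fun x hx => ⟨hx.1, hx.2.1, by linarith [hx.2.2]⟩

lemma extendedCell_subset_union :
    extendedCell ℓ k J ⊆ cell ℓ k J ∪ bridge ℓ k J ∪
      {x | x (Fin.last m) + shift m ℓ (Fin.last m) = J (Fin.last m) * edge ℓ k} := by
  intro x hx
  rcases lt_trichotomy (vert x) (vert (corner ℓ k J)) with h | h | h
  · exact Or.inl (Or.inr ⟨hx.1, hx.2.1, by linarith⟩)
  · refine Or.inr ?_
    rw [vert_corner] at h
    simpa [vert] using h
  · exact Or.inl (Or.inl ⟨hx.1, by linarith, hx.2.2⟩)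

lemma bridge_subset_cell_below (hℓ : 0 < ℓ) (hJ : J (Fin.last m) ≠ 0) :
    bridge ℓ k J ⊆ cell ℓ k (below J) := by
  have he := edge_pos hℓ k
  intro x hx
  rw [mem_cell, Fin.forall_fin_succ']
  have hcast : ((J (Fin.last m) - 1 : ℕ) : ℝ) = J (Fin.last m) - 1 := by
    rw [Nat.cast_sub (by omega), Nat.cast_one]
  refine ⟨fun i => ?_, ?_⟩
  · have := hx.1 i
    rw [corner_apply] at this
    rw [below_castSucc]
    constructor <;> linarith
  · have := hx.2
    rw [vert_corner, vert] at this
    rw [below_last, shift_last, hcast]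
    constructor <;> linarith

/-- If the bridges of two maximal good cells met, the larger of the two cells, or the cell below
it, would be a good ancestor of the smaller one. -/
lemma IsWhitney.eq_of_mem_bridge (hℓ : 0 < ℓ) (h : IsWhitney ℓ φ k J) (h' : IsWhitney ℓ φ k' J')
    (hJ : J (Fin.last m) ≠ 0) (hJ' : J' (Fin.last m) ≠ 0)
    {x : Eucl (m + 1)} (hx : x ∈ bridge ℓ k J) (hx' : x ∈ bridge ℓ k' J') :
    k = k' ∧ J = J' := by
  wlog hk : k' ≤ k generalizing k k' J J'
  · have := this h' h hJ' hJ hx' hx (by omega)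
    exact ⟨this.1.symm, this.2.symm⟩
  have ha := ancestor_eq_of_mem hℓ hk (bridge_subset_cell_below hℓ hJ hx)
    (bridge_subset_cell_below hℓ hJ' hx')
  have hi : ∀ i : Fin m, ancestor (k - k') J i.castSucc = J' i.castSucc := fun i => by
    simpa [ancestor] using congrFun ha i.castSucc
  have hl : (J (Fin.last m) - 1) / 2 ^ (k - k') = J' (Fin.last m) - 1 := by
    simpa [ancestor] using congrFun ha (Fin.last m)
  rcases hk.eq_or_lt with rfl | hlt
  · refine ⟨rfl, funext fun i => ?_⟩
    rw [Nat.sub_self, ancestor_zero] at hi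
    refine Fin.lastCases ?_ hi i
    simp only [Nat.sub_self, pow_zero, Nat.div_one] at hl
    omega
  · refine absurd (h'.good.of_le hℓ hi ?_) (h.maximal k' hlt)
    have h1 : J (Fin.last m) / 2 ^ (k - k') ≤ (J (Fin.last m) - 1 + 2 ^ (k - k')) / 2 ^ (k - k') :=
      Nat.div_le_div_right (by have : 0 < 2 ^ (k - k') := by positivity
                               omega)
    rw [Nat.add_div_right _ (by positivity), hl] at h1
    simp only [ancestor]
    omega

end Dyadic

/-! ### The tree of maximal good cells -/

/-- The index set of the maximal good cells. -/
def WhitneyIndex {m : ℕ} (ℓ : ℝ) (φ : Eucl m → ℝ) : Type :=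
  {P : ℕ × (Fin (m + 1) → ℕ) // IsWhitney ℓ φ P.1 P.2}

namespace WhitneyIndex

variable {m : ℕ} {ℓ : ℝ} {φ : Eucl m → ℝ}

instance : Countable (WhitneyIndex ℓ φ) :=
  inferInstanceAs (Countable {P : ℕ × (Fin (m + 1) → ℕ) // IsWhitney ℓ φ P.1 P.2})

/-- The generation of a maximal good cell. -/
def gen (t : WhitneyIndex ℓ φ) : ℕ := t.1.1

/-- The dyadic index of a maximal good cell. -/
def idx (t : WhitneyIndex ℓ φ) : Fin (m + 1) → ℕ := t.1.2

lemma isWhitney (t : WhitneyIndex ℓ φ) : IsWhitney ℓ φ t.gen t.idx := t.2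

lemma ext_iff {s t : WhitneyIndex ℓ φ} : s = t ↔ s.gen = t.gen ∧ s.idx = t.idx :=
  Subtype.ext_iff.trans Prod.ext_iff

/-- The cell below a maximal good cell is good, so it lies in a maximal good cell. -/
lemma exists_parent (hℓ : 0 < ℓ) (t : WhitneyIndex ℓ φ) : ∃ p : WhitneyIndex ℓ φ,
    p.gen ≤ t.gen ∧ ancestor (t.gen - p.gen) (below t.idx) = p.idx := by
  obtain ⟨k', hk', h⟩ := exists_isWhitney (ℓ := ℓ) (φ := φ) (k := t.gen) (J := below t.idx)
    (fun i => by rw [below_castSucc]; exact t.isWhitney.lt_pow i)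
    (t.isWhitney.good.of_le hℓ (fun i => below_castSucc i) (by rw [below_last]; omega))
  exact ⟨⟨(k', _), h⟩, hk', rfl⟩

/-- The parent of a maximal good cell: the maximal good cell containing the cell below it. -/
noncomputable def parent (hℓ : 0 < ℓ) (t : WhitneyIndex ℓ φ) : WhitneyIndex ℓ φ :=
  (exists_parent hℓ t).choose

lemma gen_parent_le (hℓ : 0 < ℓ) (t : WhitneyIndex ℓ φ) : (parent hℓ t).gen ≤ t.gen :=
  (exists_parent hℓ t).choose_spec.1

lemma idx_parent (hℓ : 0 < ℓ) (t : WhitneyIndex ℓ φ) :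
    ancestor (t.gen - (parent hℓ t).gen) (below t.idx) = (parent hℓ t).idx :=
  (exists_parent hℓ t).choose_spec.2

/-- The number of the layer of a cell within its column. -/
def layer (t : WhitneyIndex ℓ φ) : ℕ := t.idx (Fin.last m)

lemma exists_root
    (hφ : ∀ y ∈ centeredCube m (3 * ℓ / 2), 2 * ℓ ≤ φ y ∧ φ y < 3 * ℓ) :
    ∃ a : WhitneyIndex ℓ φ, a.gen = 0 ∧ a.idx = 0 := by
  refine ⟨⟨(0, 0), ⟨by simp, ?_, by simp⟩⟩, rfl, rfl⟩
  intro y hy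
  simp only [edge_zero, Pi.zero_apply, Nat.cast_zero, zero_mul, zero_sub, zero_add] at hy ⊢
  exact (hφ y fun i => ⟨by linarith [(hy i).1], by linarith [(hy i).2]⟩).1

variable {a : WhitneyIndex ℓ φ}

/-- The root is the only maximal good cell in the bottom layer. -/
lemma eq_root_of_layer_eq_zero (ha : a.gen = 0 ∧ a.idx = 0) {t : WhitneyIndex ℓ φ}
    (ht : t.layer = 0) : t = a := by
  have hg : ancestor t.gen t.idx = 0 := by
    ext i
    refine Fin.lastCases ?_ (fun i => ?_) i
    · rw [layer] at ht
      simp [ancestor, ht]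
    · exact Nat.div_eq_of_lt (t.isWhitney.lt_pow i)
  have hgood := a.isWhitney.good
  rw [ha.1, ha.2] at hgood
  have h0 : t.gen = 0 := by
    by_contra h
    refine t.isWhitney.maximal 0 (by omega) ?_
    rw [Nat.sub_zero, hg]
    exact hgood
  rw [h0, ancestor_zero] at hg
  rw [ext_iff, ha.1, ha.2]
  exact ⟨h0, hg⟩

lemma layer_ne_zero (ha : a.gen = 0 ∧ a.idx = 0) {t : WhitneyIndex ℓ φ} (ht : t ≠ a) :
    t.idx (Fin.last m) ≠ 0 := fun h => ht (eq_root_of_layer_eq_zero ha h)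

lemma parent_root (hℓ : 0 < ℓ) (ha : a.gen = 0 ∧ a.idx = 0) : parent hℓ a = a := by
  refine eq_root_of_layer_eq_zero ha ?_
  rw [layer, ← idx_parent hℓ a, ancestor, below_last, ha.2]
  simp

lemma layer_parent_lt (hℓ : 0 < ℓ) (ha : a.gen = 0 ∧ a.idx = 0) (t : WhitneyIndex ℓ φ)
    (ht : t ≠ a) : (parent hℓ t).layer < t.layer := by
  have h0 := layer_ne_zero ha ht
  rw [layer, ← idx_parent hℓ t, ancestor, below_last, layer]
  exact (Nat.div_le_self _ _).trans_lt (by omega)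

/-- A descendant of `t` is a later cell over the base of `t`. -/
lemma gen_le_of_descends (hℓ : 0 < ℓ) {s t : WhitneyIndex ℓ φ} (h : Descends (parent hℓ) t s) :
    t.gen ≤ s.gen ∧
      ∀ i : Fin m, s.idx i.castSucc / 2 ^ (s.gen - t.gen) = t.idx i.castSucc := by
  obtain ⟨n, hn⟩ := h
  induction n generalizing s with
  | zero =>
    obtain rfl : s = t := hn
    simp
  | succ n ih =>
    obtain ⟨h1, h2⟩ := ih (s := parent hℓ s) (by simpa using hn)
    have h3 := gen_parent_le hℓ s
    refine ⟨h1.trans h3, fun i => ?_⟩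
    rw [← h2 i, ← idx_parent hℓ s, ancestor, below_castSucc, Nat.div_div_eq_div_mul, ← pow_add]
    congr 2
    omega

end WhitneyIndex

/-! ### Distance to the graph -/

lemma norm_le_of_forall_abs_le {n : ℕ} {v : Eucl n} {r : ℝ} (hr : 0 ≤ r) (h : ∀ i, |v i| ≤ r) :
    ‖v‖ ≤ n * r := by
  rw [EuclideanSpace.norm_eq, Real.sqrt_le_iff]
  refine ⟨by positivity, ?_⟩
  calc ∑ i, ‖v i‖ ^ 2 ≤ ∑ _i : Fin n, r ^ 2 := by
        gcongr with i
        exact h i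
    _ = n * r ^ 2 := by simp
    _ ≤ n ^ 2 * r ^ 2 := by
        gcongr
        exact_mod_cast Nat.le_self_pow two_ne_zero n
    _ = (n * r) ^ 2 := by ring

section Geometry

variable {m : ℕ} {ℓ : ℝ} {φ : Eucl m → ℝ} {α K : ℝ≥0} {k : ℕ} {J : Fin (m + 1) → ℕ}

lemma abs_horiz_sub_le (x y : Eucl (m + 1)) (i : Fin m) : |horiz x i - horiz y i| ≤ dist x y := by
  rw [dist_eq_norm]
  exact PiLp.norm_apply_le (x - y) i.castSucc

lemma abs_vert_sub_le (x y : Eucl (m + 1)) : |vert x - vert y| ≤ dist x y := by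
  rw [dist_eq_norm]
  exact PiLp.norm_apply_le (x - y) (Fin.last m)

lemma succ_mul_edge_le (hℓ : 0 < ℓ) {j : ℕ} (hj : j < 2 ^ k) : ((j : ℝ) + 1) * edge ℓ k ≤ ℓ := by
  have he := edge_pos hℓ k
  have h1 : (j : ℝ) + 1 ≤ 2 ^ k := mod_cast hj
  calc ((j : ℝ) + 1) * edge ℓ k ≤ 2 ^ k * edge ℓ k := by gcongr
    _ = ℓ := two_pow_mul_edge k

/-- The neighbourhood of the base used in `IsGood` stays inside the cube where `φ` is
controlled. -/
lemma mem_centeredCube_of_near (hℓ : 0 < ℓ) (hJ : ∀ i : Fin m, J i.castSucc < 2 ^ k) {y : Eucl m}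
    (hy : ∀ i : Fin m, J i.castSucc * edge ℓ k - edge ℓ k < y i + ℓ / 2 ∧
      y i + ℓ / 2 < J i.castSucc * edge ℓ k + 2 * edge ℓ k) :
    y ∈ centeredCube m (3 * ℓ / 2) := by
  intro i
  have he := edge_pos hℓ k
  have he' : edge ℓ k ≤ ℓ := (edge_le hℓ (Nat.zero_le k)).trans_eq edge_zero
  have h2 := succ_mul_edge_le hℓ (hJ i)
  have h3 : 0 ≤ (J i.castSucc : ℝ) * edge ℓ k := by positivity
  obtain ⟨h4, h5⟩ := hy i
  constructor <;> linarith

lemma horiz_near {x : Eucl (m + 1)} (hx : x ∈ extendedCell ℓ k J) (i : Fin m) :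
    J i.castSucc * edge ℓ k < horiz x i + ℓ / 2 ∧
      horiz x i + ℓ / 2 < (J i.castSucc + 1) * edge ℓ k := by
  have := hx.1 i
  rw [corner_apply, shift_castSucc] at this
  simp only [horiz]
  constructor <;> linarith

/-- On an extended good cell the distance to the graph is at least the edge. -/
lemma edge_le_distGraph (hℓ : 0 < ℓ)
    (hg : IsGood ℓ φ k J) (x : Eucl (m + 1)) (hx : x ∈ extendedCell ℓ k J) :
    edge ℓ k ≤ distGraph ℓ φ x := by
  have he := edge_pos hℓ k
  have hne : (bigGraph ℓ φ).Nonempty := by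
    refine ⟨WithLp.toLp 2 (Fin.snoc (α := fun _ => ℝ) (fun _ => 0) (φ 0)), ?_, ?_⟩
    · intro i
      simp only [horiz, Fin.snoc_castSucc]
      constructor <;> linarith
    · have : horiz (WithLp.toLp 2 (Fin.snoc (α := fun _ => ℝ) (fun _ => 0) (φ 0)) :
          Eucl (m + 1)) = 0 := by
        ext i
        simp [horiz]
      rw [this]
      simp [vert]
  refine (Metric.le_infDist hne).2 fun y hy => ?_
  by_cases hnear : ∀ i : Fin m, J i.castSucc * edge ℓ k - edge ℓ k < horiz y i + ℓ / 2 ∧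
      horiz y i + ℓ / 2 < J i.castSucc * edge ℓ k + 2 * edge ℓ k
  · have h1 := hg _ hnear
    have h2 := hx.2.2
    rw [vert_corner] at h2
    have h3 := hy.2
    have h4 := abs_le.1 (abs_vert_sub_le x y)
    linarith
  · push Not at hnear
    obtain ⟨i, hi⟩ := hnear
    have h1 := horiz_near hx i
    have h2 := abs_le.1 (abs_horiz_sub_le x y i)
    by_cases h3 : J i.castSucc * edge ℓ k - edge ℓ k < horiz y i + ℓ / 2
    · have := hi h3
      linarith
    · linarith

/-- A maximal good cell has a point of the graph nearby. As `φ` is merely Hölder continuous, the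
height of this point is controlled from below by the intermediate value theorem. -/
lemma exists_graph_point (hℓ : 0 < ℓ) (hα : 0 < α)
    (hφ : HolderOnWith K α φ (centeredCube m (3 * ℓ / 2)))
    (hφ_range : ∀ y ∈ centeredCube m (3 * ℓ / 2), 2 * ℓ ≤ φ y ∧ φ y < 3 * ℓ)
    (h : IsWhitney ℓ φ k J) :
    ∃ y ∈ centeredCube m (3 * ℓ / 2), (∀ i, |y i - horiz (corner ℓ k J) i| ≤ 4 * edge ℓ k) ∧
      vert (corner ℓ k J) ≤ φ y ∧ φ y ≤ vert (corner ℓ k J) + 4 * edge ℓ k := by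
  have he := edge_pos hℓ k
  set z : Eucl m := horiz (corner ℓ k J) with hz
  have hzi : ∀ i, z i = J i.castSucc * edge ℓ k - ℓ / 2 := fun i => by
    rw [hz, horiz]
    simp [corner_apply]
  have hznear : ∀ i : Fin m, J i.castSucc * edge ℓ k - edge ℓ k < z i + ℓ / 2 ∧
      z i + ℓ / 2 < J i.castSucc * edge ℓ k + 2 * edge ℓ k := fun i => by
    rw [hzi]
    constructor <;> linarith
  have hzg := h.good z hznear
  have hzc := mem_centeredCube_of_near hℓ h.lt_pow hznear
  rw [vert_corner]
  rcases Nat.eq_zero_or_pos k with rfl | hk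
  · refine ⟨z, hzc, fun i => by rw [sub_self, abs_zero]; positivity, by linarith, ?_⟩
    have h1 := (hφ_range z hzc).2
    have h2 : 0 ≤ (J (Fin.last m) : ℝ) * edge ℓ 0 := by positivity
    rw [edge_zero] at h2 ⊢
    linarith
  · have hbad := h.maximal (k - 1) (by omega)
    rw [show k - (k - 1) = 1 by omega] at hbad
    set J' := ancestor 1 J with hJ'
    have hk1 : k - 1 ≤ k := by omega
    have hb := fun i => ancestor_bounds (J := J) hℓ hk1 i
    rw [show k - (k - 1) = 1 by omega, edge_sub hk1, show k - (k - 1) = 1 by omega, pow_one,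
      ← hJ'] at hb
    rw [IsGood, edge_sub hk1, show k - (k - 1) = 1 by omega, pow_one] at hbad
    push Not at hbad
    obtain ⟨y, hy, hφy⟩ := hbad
    have hlast := (hb (Fin.last m)).1
    have hJ'lt : ∀ i : Fin m, J' i.castSucc < 2 ^ (k - 1) := fun i => by
      rw [hJ', ancestor, Nat.div_lt_iff_lt_mul (by positivity), ← pow_add,
        Nat.sub_add_cancel (by omega)]
      exact h.lt_pow i
    -- the neighbourhood attached to the dyadic parent, which is convex and contains `y` and `z`
    set S : Set (Eucl m) := {u | ∀ i : Fin m,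
      J' i.castSucc * (2 * edge ℓ k) - 2 * edge ℓ k < u i + ℓ / 2 ∧
        u i + ℓ / 2 < J' i.castSucc * (2 * edge ℓ k) + 2 * (2 * edge ℓ k)}
    have hSconv : Convex ℝ S := by
      intro u hu v hv s t hs ht hst i
      have h1 := hu i
      have h2 := hv i
      simp only [PiLp.add_apply, PiLp.smul_apply, smul_eq_mul]
      have h3 := convex_Ioo (J' i.castSucc * (2 * edge ℓ k) - 2 * edge ℓ k - ℓ / 2)
        (J' i.castSucc * (2 * edge ℓ k) + 2 * (2 * edge ℓ k) - ℓ / 2)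
        (x := u i) ⟨by linarith, by linarith⟩ (y := v i) ⟨by linarith, by linarith⟩ hs ht hst
      rw [mem_Ioo, smul_eq_mul, smul_eq_mul] at h3
      constructor <;> linarith [h3.1, h3.2]
    have hSsub : S ⊆ centeredCube m (3 * ℓ / 2) := by
      intro u hu
      refine mem_centeredCube_of_near hℓ hJ'lt fun i => ?_
      rw [edge_sub hk1, show k - (k - 1) = 1 by omega, pow_one]
      exact hu i
    have hzS : z ∈ S := fun i => by
      have := hb i.castSucc
      rw [hzi]
      constructor <;> linarith
    have hSz : ∀ u ∈ S, ∀ i, |u i - z i| ≤ 4 * edge ℓ k := fun u hu i => by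
      have h1 := hb i.castSucc
      have h2 := hu i
      rw [hzi, abs_le]
      constructor <;> linarith
    have hcont : ContinuousOn φ S := (hφ.mono hSsub).continuousOn hα
    by_cases hlow : (J (Fin.last m) : ℝ) * edge ℓ k ≤ φ y
    · exact ⟨y, hSsub hy, hSz y hy, hlow, by linarith⟩
    · obtain ⟨u, hu, hφu⟩ := hSconv.isPreconnected.intermediate_value hy hzS hcont
        (show (J (Fin.last m) : ℝ) * edge ℓ k ∈ Icc (φ y) (φ z) from ⟨by linarith, by linarith⟩)
      exact ⟨u, hSsub hu, hSz u hu, hφu.ge, by linarith⟩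

lemma distGraph_le (hℓ : 0 < ℓ) (hα : 0 < α)
    (hφ : HolderOnWith K α φ (centeredCube m (3 * ℓ / 2)))
    (hφ_range : ∀ y ∈ centeredCube m (3 * ℓ / 2), 2 * ℓ ≤ φ y ∧ φ y < 3 * ℓ)
    (h : IsWhitney ℓ φ k J) {x : Eucl (m + 1)} (hx : x ∈ extendedCell ℓ k J) :
    distGraph ℓ φ x ≤ 5 * (m + 1) * edge ℓ k := by
  have he := edge_pos hℓ k
  obtain ⟨y, hyc, hyz, h1, h2⟩ := exists_graph_point hℓ hα hφ hφ_range h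
  set g : Eucl (m + 1) := WithLp.toLp 2 (Fin.snoc (α := fun _ => ℝ) (fun i => y i) (φ y)) with hg
  have hgh : horiz g = y := by
    ext i
    simp [horiz, hg]
  have hgv : vert g = φ y := by simp [vert, hg]
  have hgG : g ∈ bigGraph ℓ φ := ⟨by rw [hgh]; exact hyc, by rw [hgh, hgv]⟩
  refine (Metric.infDist_le_dist_of_mem hgG).trans ?_
  rw [dist_eq_norm]
  have := norm_le_of_forall_abs_le (v := x - g) (r := 5 * edge ℓ k) (by positivity) fun i => by
    refine Fin.lastCases ?_ (fun i => ?_) i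
    · have h3 := hx.2
      rw [PiLp.sub_apply, show g (Fin.last m) = φ y from hgv,
        show x (Fin.last m) = vert x from rfl, abs_le]
      constructor <;> linarith
    · have h3 := hx.1 i
      have h4 := abs_le.1 (hyz i)
      rw [show horiz (corner ℓ k J) i = corner ℓ k J i.castSucc from rfl] at h4
      rw [PiLp.sub_apply, show g i.castSucc = y i by rw [← hgh]; rfl, abs_le]
      constructor <;> linarith
  push_cast at this
  linarith

lemma mem_graphRegion (hℓ : 0 < ℓ) (h : IsWhitney ℓ φ k J) {x : Eucl (m + 1)}
    (hx : x ∈ extendedCell ℓ k J) (hx0 : 0 < vert x) : x ∈ graphRegion ℓ φ := by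
  have he := edge_pos hℓ k
  have hnear := horiz_near hx
  have h1 := h.good (horiz x) fun i => by
    obtain ⟨h1, h2⟩ := hnear i
    constructor <;> linarith
  have h2 := hx.2
  rw [vert_corner] at h2
  refine ⟨fun i => ?_, hx0, by linarith⟩
  obtain ⟨h5, h6⟩ := hnear i
  have h8 := succ_mul_edge_le hℓ (h.lt_pow i)
  have h9 : 0 ≤ (J i.castSucc : ℝ) * edge ℓ k := by positivity
  constructor <;> linarith

lemma extendedCell_subset (hℓ : 0 < ℓ) (h : IsWhitney ℓ φ k J) (hJ : J (Fin.last m) ≠ 0) :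
    extendedCell ℓ k J ⊆ graphRegion ℓ φ := by
  have he := edge_pos hℓ k
  intro x hx
  refine mem_graphRegion hℓ h hx ?_
  have h2 := hx.2
  rw [vert_corner] at h2
  have h3 : (1 : ℝ) ≤ J (Fin.last m) := mod_cast Nat.one_le_iff_ne_zero.2 hJ
  have h4 : 1 * edge ℓ k ≤ J (Fin.last m) * edge ℓ k := by gcongr
  linarith

lemma cell_subset (hℓ : 0 < ℓ) (h : IsWhitney ℓ φ k J) : cell ℓ k J ⊆ graphRegion ℓ φ := by
  have he := edge_pos hℓ k
  intro x hx
  refine mem_graphRegion hℓ h (cell_subset_extendedCell hℓ hx) ?_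
  have h2 := hx.2
  rw [vert_corner] at h2
  have h4 : 0 ≤ J (Fin.last m) * edge ℓ k := by positivity
  linarith

lemma abs_sub_le_of_holder (hφ : HolderOnWith K α φ (centeredCube m (3 * ℓ / 2))) {y z : Eucl m}
    (hy : y ∈ centeredCube m (3 * ℓ / 2)) (hz : z ∈ centeredCube m (3 * ℓ / 2)) {r : ℝ}
    (hr : 0 ≤ r) (h : ∀ i, |y i - z i| ≤ r) : |φ y - φ z| ≤ K * (m * r) ^ (α : ℝ) := by
  have h1 := hφ.dist_le hy hz
  rw [Real.dist_eq] at h1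
  refine h1.trans ?_
  gcongr
  rw [dist_eq_norm]
  exact norm_le_of_forall_abs_le hr h

/-- Every point of the region off the dyadic hyperplanes lies in a good cell, as `φ` is
continuous. -/
lemma exists_mem_cell (hℓ : 0 < ℓ) (hα : 0 < α)
    (hφ : HolderOnWith K α φ (centeredCube m (3 * ℓ / 2))) {x : Eucl (m + 1)}
    (hx : x ∈ graphRegion ℓ φ)
    (hgrid : ∀ (k : ℕ) (i : Fin (m + 1)) (j : ℕ), x i + shift m ℓ i ≠ j * edge ℓ k) :
    ∃ t : WhitneyIndex ℓ φ, x ∈ cell ℓ t.gen t.idx := by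
  obtain ⟨hxh, hx0, hxφ⟩ := hx
  have hlim : Filter.Tendsto
      (fun k => (K : ℝ) * (m * (2 * edge ℓ k)) ^ (α : ℝ) + 2 * edge ℓ k) Filter.atTop
      (nhds 0) := by
    have he : Filter.Tendsto (fun k => edge ℓ k) Filter.atTop (nhds 0) := by
      have := (tendsto_pow_atTop_nhds_zero_of_lt_one (r := (1 / 2 : ℝ)) (by norm_num)
        (by norm_num)).const_mul ℓ
      rw [mul_zero] at this
      refine this.congr fun k => ?_
      rw [edge, one_div, inv_pow, div_eq_mul_inv]
    have hc : Continuous fun e : ℝ => (K : ℝ) * (m * (2 * e)) ^ (α : ℝ) + 2 * e :=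
      ((((continuous_const.mul continuous_id).const_mul _).rpow_const
        fun _ => Or.inr α.2).const_mul _).add (continuous_const.mul continuous_id)
    have hα' : (α : ℝ) ≠ 0 := by exact_mod_cast hα.ne'
    have h0 : (K : ℝ) * (m * (2 * 0)) ^ (α : ℝ) + 2 * 0 = 0 := by simp [Real.zero_rpow hα']
    have h1 := hc.tendsto 0
    rw [h0] at h1
    exact h1.comp he
  obtain ⟨k, hk⟩ := (hlim.eventually_lt_const (sub_pos.2 hxφ)).exists
  have he := edge_pos hℓ k
  have hpos : ∀ i, 0 < x i + shift m ℓ i := fun i => by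
    refine Fin.lastCases ?_ (fun i => ?_) i
    · rw [shift_last, add_zero]
      exact hx0
    · have h1 := (hxh i).1
      simp only [horiz] at h1
      rw [shift_castSucc]
      linarith
  set J : Fin (m + 1) → ℕ := fun i => ⌊(x i + shift m ℓ i) / edge ℓ k⌋₊
  have hxJ : x ∈ cell ℓ k J := by
    rw [mem_cell]
    intro i
    have h1 := Nat.floor_le (div_pos (hpos i) he).le
    have h2 := Nat.lt_floor_add_one ((x i + shift m ℓ i) / edge ℓ k)
    rw [le_div_iff₀ he] at h1
    rw [div_lt_iff₀ he] at h2
    exact ⟨lt_of_le_of_ne h1 (hgrid k i _).symm, h2⟩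
  have hnear := horiz_near (cell_subset_extendedCell hℓ hxJ)
  have hlt : ∀ i : Fin m, J i.castSucc < 2 ^ k := fun i => by
    have h1 := (hnear i).1
    have h2 := (hxh i).2
    have h3 : (J i.castSucc : ℝ) * edge ℓ k < 2 ^ k * edge ℓ k := by
      rw [two_pow_mul_edge]
      linarith
    exact_mod_cast lt_of_mul_lt_mul_right h3 he.le
  have hgood : IsGood ℓ φ k J := by
    intro y hy
    have hyc := mem_centeredCube_of_near hℓ hlt hy
    have hxc : horiz x ∈ centeredCube m (3 * ℓ / 2) := fun i => by
      have := hxh i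
      constructor <;> linarith [this.1, this.2]
    have h1 := abs_sub_le_of_holder hφ hyc hxc (r := 2 * edge ℓ k) (by positivity) fun i => by
      have h2 := hnear i
      have h3 := hy i
      rw [abs_le]
      constructor <;> linarith
    have h2 := hxJ.2.1
    rw [vert_corner] at h2
    have h3 := abs_le.1 h1
    linarith
  obtain ⟨k', hk', hW⟩ := exists_isWhitney hlt hgood
  exact ⟨⟨(k', _), hW⟩, cell_subset_ancestor hℓ hk' hxJ⟩

/-- In each column, the cells of a given edge `e` fill heights between `φ - C e ^ α` and `φ`, so
there are at most `M e ^ (α - 1)` of them. -/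
lemma exists_column_bound (hℓ : 0 < ℓ) (hα : 0 < α) (hα1 : α ≤ 1)
    (hφ : HolderOnWith K α φ (centeredCube m (3 * ℓ / 2)))
    (hφ_range : ∀ y ∈ centeredCube m (3 * ℓ / 2), 2 * ℓ ≤ φ y ∧ φ y < 3 * ℓ) :
    ∃ M : ℝ≥0∞, M ≠ ∞ ∧ ∀ k (j : Fin m → ℕ), ∑' s : WhitneyIndex ℓ φ,
      ind (s.gen = k ∧ (fun i : Fin m => s.idx i.castSucc) = j) ≤ M * decay ((α : ℝ) - 1) k := by
  -- two layers of a column differ by at most `2 + K (4 m e) ^ α / e = 2 + D 2 ^ (k (1 - α))`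
  set D : ℝ := K * (4 * m * ℓ) ^ (α : ℝ) / ℓ with hD
  have hD0 : 0 ≤ D := by positivity
  refine ⟨ENNReal.ofReal (3 + D), ENNReal.ofReal_ne_top, fun k j => ?_⟩
  have he := edge_pos hℓ k
  set T : Set (WhitneyIndex ℓ φ) :=
    {s | s.gen = k ∧ (fun i : Fin m => s.idx i.castSucc) = j} with hT
  have hdec : decay ((α : ℝ) - 1) k = ENNReal.ofReal ((2 ^ k) ^ (1 - (α : ℝ))) := by
    rw [decay_eq_ofReal, neg_sub]
  have hone : 1 ≤ ((2 : ℝ) ^ k) ^ (1 - (α : ℝ)) :=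
    Real.one_le_rpow (one_le_pow₀ (by norm_num)) (sub_nonneg.2 (by exact_mod_cast hα1))
  -- `K (4 m e) ^ α / e = D 2 ^ (k (1 - α))`
  have hDk : K * (m * (4 * edge ℓ k)) ^ (α : ℝ) =
      D * (2 ^ k) ^ (1 - (α : ℝ)) * edge ℓ k := by
    have h2 : (0 : ℝ) < 2 ^ k := by positivity
    rw [hD, edge, show (m : ℝ) * (4 * (ℓ / 2 ^ k)) = (4 * m * ℓ) / 2 ^ k by ring,
      Real.div_rpow (by positivity) h2.le, Real.rpow_sub h2, Real.rpow_one]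
    have h3 : (0 : ℝ) < (2 ^ k) ^ (α : ℝ) := by positivity
    field_simp
  have hlow : ∀ s ∈ T, ∀ s' ∈ T, (s.layer : ℝ) ≤ s'.layer + (2 + D * (2 ^ k) ^ (1 - (α : ℝ))) := by
    rintro s ⟨hsk, hsj⟩ s' ⟨hsk', hsj'⟩
    have hs := s.isWhitney
    have hs' := s'.isWhitney
    rw [hsk] at hs
    rw [hsk'] at hs'
    have hcs : ∀ i : Fin m, s.idx i.castSucc = s'.idx i.castSucc := fun i =>
      (congrFun hsj i).trans (congrFun hsj' i).symm
    obtain ⟨y, hyc, hyz, -, h2⟩ := exists_graph_point hℓ hα hφ hφ_range hs'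
    set z : Eucl m := horiz (corner ℓ k s'.idx) with hz
    have hznear : ∀ i : Fin m, s.idx i.castSucc * edge ℓ k - edge ℓ k < z i + ℓ / 2 ∧
        z i + ℓ / 2 < s.idx i.castSucc * edge ℓ k + 2 * edge ℓ k := fun i => by
      have hzi : z i = s'.idx i.castSucc * edge ℓ k - ℓ / 2 := by
        rw [hz, horiz]
        simp [corner_apply]
      rw [hzi, hcs]
      constructor <;> linarith
    have h3 := hs.good z hznear
    have hzc := mem_centeredCube_of_near hℓ hs.lt_pow hznear
    have h4 := abs_le.1 (abs_sub_le_of_holder hφ hyc hzc (by positivity) hyz)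
    rw [hDk] at h4
    rw [vert_corner] at h2
    refine le_of_mul_le_mul_right ?_ he
    rw [WhitneyIndex.layer, WhitneyIndex.layer]
    linarith
  by_cases hTne : T.Nonempty
  · -- the lowest cell of the column
    obtain ⟨s₀, hs₀, hmin⟩ := WellFounded.has_min
      (InvImage.wf (WhitneyIndex.layer (ℓ := ℓ) (φ := φ)) wellFounded_lt) T hTne
    set N : ℕ := ⌊2 + D * ((2 : ℝ) ^ k) ^ (1 - (α : ℝ))⌋₊
    have hmaps : ∀ s ∈ T, s.layer ∈ Finset.Icc s₀.layer (s₀.layer + N) := by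
      intro s hs
      rw [Finset.mem_Icc]
      have h1 : s₀.layer ≤ s.layer := not_lt.1 (hmin s hs)
      refine ⟨h1, ?_⟩
      have h2 := hlow s hs s₀ hs₀
      have h3 : s.layer - s₀.layer ≤ N := by
        refine Nat.le_floor ?_
        rw [Nat.cast_sub h1]
        linarith
      omega
    have hinj : InjOn WhitneyIndex.layer T := by
      rintro s ⟨hsk, hsj⟩ s' ⟨hsk', hsj'⟩ hl
      rw [WhitneyIndex.ext_iff]
      refine ⟨hsk.trans hsk'.symm, funext fun i => ?_⟩
      refine Fin.lastCases hl (fun i => ?_) i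
      exact (congrFun hsj i).trans (congrFun hsj' i).symm
    have hfin : T.Finite := Set.Finite.of_finite_image (f := WhitneyIndex.layer)
      ((Finset.finite_toSet _).subset (Set.image_subset_iff.2 fun s hs => Finset.mem_coe.2 (hmaps s hs))) hinj
    calc ∑' s : WhitneyIndex ℓ φ, ind (s.gen = k ∧ (fun i : Fin m => s.idx i.castSucc) = j)
        = ∑ s ∈ hfin.toFinset, ind (s.gen = k ∧ (fun i : Fin m => s.idx i.castSucc) = j) := by
          refine tsum_eq_sum fun s hs => ind_of_not ?_
          simpa [hT] using hs
      _ = (hfin.toFinset.card : ℝ≥0∞) := by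
          rw [Finset.sum_congr rfl fun s hs => ind_of (by simpa [hT] using hs), Finset.sum_const,
            nsmul_one]
      _ ≤ ((N + 1 : ℕ) : ℝ≥0∞) := by
          have h1 := Finset.card_le_card_of_injOn (s := hfin.toFinset)
            (t := Finset.Icc s₀.layer (s₀.layer + N)) WhitneyIndex.layer
            (fun s hs => hmaps s (by simpa using hs)) (by simpa using hinj)
          rw [Nat.card_Icc] at h1
          exact_mod_cast h1.trans (by omega)
      _ ≤ ENNReal.ofReal ((3 + D) * (2 ^ k) ^ (1 - (α : ℝ))) := by
          rw [← ENNReal.ofReal_natCast]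
          refine ENNReal.ofReal_le_ofReal ?_
          have h1 : (N : ℝ) ≤ 2 + D * (2 ^ k) ^ (1 - (α : ℝ)) := Nat.floor_le (by positivity)
          push_cast
          linarith
      _ = _ := by rw [ENNReal.ofReal_mul (by positivity), hdec]
  · rw [Set.not_nonempty_iff_eq_empty] at hTne
    have : ∀ s : WhitneyIndex ℓ φ,
        ind (s.gen = k ∧ (fun i : Fin m => s.idx i.castSucc) = j) = 0 := fun s =>
      ind_of_not fun hs => (hTne ▸ (show s ∈ T from hs) : s ∈ (∅ : Set (WhitneyIndex ℓ φ)))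
    simp only [this, tsum_zero]
    exact zero_le

/-- There are finitely many maximal good cells in each generation. -/
lemma finite_gen_le (hℓ : 0 < ℓ)
    (hφ_range : ∀ y ∈ centeredCube m (3 * ℓ / 2), 2 * ℓ ≤ φ y ∧ φ y < 3 * ℓ) (N : ℕ) :
    {s : WhitneyIndex ℓ φ | s.gen ≤ N}.Finite := by
  have hbd : ∀ s : WhitneyIndex ℓ φ, s.gen ≤ N → ∀ i, s.idx i ≤ 3 * 2 ^ N := by
    intro s hs i
    have hpow : 2 ^ s.gen ≤ 2 ^ N := Nat.pow_le_pow_right (by norm_num) hs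
    refine Fin.lastCases ?_ (fun i => ?_) i
    · have he := edge_pos hℓ s.gen
      have hznear : ∀ i : Fin m, s.idx i.castSucc * edge ℓ s.gen - edge ℓ s.gen <
          horiz (corner ℓ s.gen s.idx) i + ℓ / 2 ∧ horiz (corner ℓ s.gen s.idx) i + ℓ / 2 <
            s.idx i.castSucc * edge ℓ s.gen + 2 * edge ℓ s.gen := fun i => by
        simp only [horiz, corner_apply, shift_castSucc]
        constructor <;> linarith
      have h1 := s.isWhitney.good _ hznear
      have h2 := (hφ_range _ (mem_centeredCube_of_near hℓ s.isWhitney.lt_pow hznear)).2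
      have h3 : (s.idx (Fin.last m) : ℝ) * edge ℓ s.gen < (3 * 2 ^ s.gen) * edge ℓ s.gen := by
        rw [mul_assoc, two_pow_mul_edge]
        linarith
      have h4 : s.idx (Fin.last m) < 3 * 2 ^ s.gen := by
        exact_mod_cast lt_of_mul_lt_mul_right h3 he.le
      omega
    · have := s.isWhitney.lt_pow i
      omega
  refine Set.Finite.of_finite_image (f := Subtype.val) ?_ Subtype.val_injective.injOn
  refine ((Set.finite_Iic N).prod (Set.finite_Iic fun _ : Fin (m + 1) => 3 * 2 ^ N)).subset ?_
  rintro _ ⟨s, hs, rfl⟩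
  exact ⟨hs, fun i => hbd s hs i⟩

end Geometry

/-! ### Volumes -/

section Volume

variable {m : ℕ} {ℓ : ℝ}

lemma box_eq_preimage (z : Eucl (m + 1)) (e lo hi : ℝ) :
    box z e lo hi = WithLp.ofLp ⁻¹' (Set.univ.pi fun i =>
      if i = Fin.last m then Ioo (z i + lo) (z i + hi) else Ioo (z i) (z i + e)) := by
  ext x
  simp only [mem_preimage, mem_pi, mem_univ, true_implies]
  rw [Fin.forall_fin_succ']
  simp [box, vert, (Fin.castSucc_lt_last _).ne]

lemma volume_box (z : Eucl (m + 1)) (e lo hi : ℝ) :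
    volume (box z e lo hi) = ENNReal.ofReal e ^ m * ENNReal.ofReal (hi - lo) := by
  rw [box_eq_preimage, (PiLp.volume_preserving_ofLp (Fin (m + 1))).measure_preimage
      (MeasurableSet.univ_pi fun i => by
        split_ifs <;> exact measurableSet_Ioo).nullMeasurableSet, volume_pi_pi, Fin.prod_univ_castSucc]
  simp [(Fin.castSucc_lt_last _).ne]

lemma isOpen_box (z : Eucl (m + 1)) (e lo hi : ℝ) : IsOpen (box z e lo hi) := by
  rw [box_eq_preimage]
  refine (isOpen_set_pi finite_univ fun i _ => ?_).preimage (PiLp.continuous_ofLp 2 _)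
  split_ifs <;> exact isOpen_Ioo

/-- Almost every point lies on no dyadic hyperplane. -/
lemma ae_notMem_grid : ∀ᵐ x : Eucl (m + 1), ∀ (k : ℕ) (i : Fin (m + 1)) (j : ℕ),
    x i + shift m ℓ i ≠ j * edge ℓ k := by
  simp only [ae_all_iff]
  intro k i j
  rw [ae_iff]
  have h : {x : Eucl (m + 1) | ¬ (x i + shift m ℓ i ≠ j * edge ℓ k)} =
      WithLp.ofLp ⁻¹' {y : Fin (m + 1) → ℝ | y i = j * edge ℓ k - shift m ℓ i} := by
    ext x
    simp [eq_sub_iff_add_eq]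
  rw [h, (PiLp.volume_preserving_ofLp (Fin (m + 1))).measure_preimage
    (measurableSet_eq_fun (measurable_pi_apply i) measurable_const).nullMeasurableSet]
  exact Measure.pi_hyperplane _ i _

end Volume

/-! ### The Whitney covering -/

namespace WhitneyIndex

variable {m : ℕ} {ℓ : ℝ} {φ : Eucl m → ℝ} {α K : ℝ≥0}

/-- The maximal good cell with index `t`. -/
noncomputable def Q (t : WhitneyIndex ℓ φ) : Set (Eucl (m + 1)) := cell ℓ t.gen t.idx

open scoped Classical in
/-- The covering: the maximal good cells, extended downward except for the root `a`. -/
noncomputable def U (a t : WhitneyIndex ℓ φ) : Set (Eucl (m + 1)) :=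
  if t = a then t.Q else extendedCell ℓ t.gen t.idx

open scoped Classical in
/-- The bridges: the parts added by the extension, and `∅` at the root `a`. -/
noncomputable def B (a t : WhitneyIndex ℓ φ) : Set (Eucl (m + 1)) :=
  if t = a then ∅ else bridge ℓ t.gen t.idx

lemma U_root (a : WhitneyIndex ℓ φ) : U a a = a.Q := if_pos rfl

lemma U_of_ne {a t : WhitneyIndex ℓ φ} (h : t ≠ a) : U a t = extendedCell ℓ t.gen t.idx :=
  if_neg h

lemma B_root (a : WhitneyIndex ℓ φ) : B a a = ∅ := if_pos rfl

lemma B_of_ne {a t : WhitneyIndex ℓ φ} (h : t ≠ a) : B a t = bridge ℓ t.gen t.idx := if_neg h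

variable {a : WhitneyIndex ℓ φ}

lemma Q_subset_U (hℓ : 0 < ℓ) (t : WhitneyIndex ℓ φ) : t.Q ⊆ U a t := by
  by_cases h : t = a
  · rw [h, U_root]
  · rw [U_of_ne h]
    exact cell_subset_extendedCell hℓ

lemma B_subset_U (hℓ : 0 < ℓ) (t : WhitneyIndex ℓ φ) : B a t ⊆ U a t := by
  by_cases h : t = a
  · rw [h, B_root]
    exact empty_subset _
  · rw [U_of_ne h, B_of_ne h]
    exact bridge_subset_extendedCell hℓ

lemma U_subset_extendedCell (hℓ : 0 < ℓ) (t : WhitneyIndex ℓ φ) :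
    U a t ⊆ extendedCell ℓ t.gen t.idx := by
  by_cases h : t = a
  · rw [h, U_root]
    exact cell_subset_extendedCell hℓ
  · rw [U_of_ne h]

lemma isOpen_U (t : WhitneyIndex ℓ φ) : IsOpen (U a t) := by
  rw [U]
  split_ifs <;> exact isOpen_box _ _ _ _

lemma isOpen_B (t : WhitneyIndex ℓ φ) : IsOpen (B a t) := by
  rw [B]
  split_ifs
  exacts [isOpen_empty, isOpen_box _ _ _ _]

lemma U_subset (hℓ : 0 < ℓ) (ha : a.gen = 0 ∧ a.idx = 0) (t : WhitneyIndex ℓ φ) :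
    U a t ⊆ graphRegion ℓ φ := by
  by_cases h : t = a
  · rw [h, U_root]
    exact cell_subset hℓ a.isWhitney
  · rw [U_of_ne h]
    exact extendedCell_subset hℓ t.isWhitney (layer_ne_zero ha h)

lemma Q_subset (hℓ : 0 < ℓ) (t : WhitneyIndex ℓ φ) : t.Q ⊆ graphRegion ℓ φ :=
  cell_subset hℓ t.isWhitney

lemma measurableSet_Q (t : WhitneyIndex ℓ φ) : MeasurableSet t.Q :=
  (isOpen_box _ _ _ _).measurableSet

lemma disjoint_Q (hℓ : 0 < ℓ) :
    Pairwise (Function.onFun Disjoint (Q : WhitneyIndex ℓ φ → Set (Eucl (m + 1)))) := by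
  intro s t hst
  rw [Function.onFun, Set.disjoint_left]
  exact fun x hs ht => hst (ext_iff.2 (s.isWhitney.eq_of_mem hℓ t.isWhitney hs ht))

lemma disjoint_B (hℓ : 0 < ℓ) (ha : a.gen = 0 ∧ a.idx = 0) :
    Pairwise (Function.onFun Disjoint (B a)) := by
  intro s t hst
  rw [Function.onFun]
  by_cases hs : s = a
  · rw [hs, B_root]
    exact empty_disjoint _
  by_cases ht : t = a
  · rw [ht, B_root]
    exact disjoint_empty _
  rw [B_of_ne hs, B_of_ne ht, Set.disjoint_left]
  exact fun x hxs hxt => hst (ext_iff.2 (s.isWhitney.eq_of_mem_bridge hℓ t.isWhitney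
    (layer_ne_zero ha hs) (layer_ne_zero ha ht) hxs hxt))

lemma B_subset (hℓ : 0 < ℓ) (ha : a.gen = 0 ∧ a.idx = 0) (t : WhitneyIndex ℓ φ) (ht : t ≠ a) :
    B a t ⊆ (parent hℓ t).Q := by
  rw [B_of_ne ht, Q, ← idx_parent hℓ t]
  exact (bridge_subset_cell_below hℓ (layer_ne_zero ha ht)).trans
    (cell_subset_ancestor hℓ (gen_parent_le hℓ t))

lemma volume_Q (hℓ : 0 < ℓ) (t : WhitneyIndex ℓ φ) :
    volume t.Q = ENNReal.ofReal (ℓ ^ (m + 1)) * decay (m + 1) t.gen := by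
  rw [Q, cell, volume_box, sub_zero, ← pow_succ, decay_eq_ofReal,
    ← ENNReal.ofReal_pow (edge_pos hℓ _).le, ← ENNReal.ofReal_mul (by positivity), edge, div_pow,
    Real.rpow_neg (by positivity), div_eq_mul_inv]
  norm_cast

lemma volume_B (hℓ : 0 < ℓ) {t : WhitneyIndex ℓ φ} (ht : t ≠ a) :
    volume (B a t) = ENNReal.ofReal (ℓ ^ (m + 1) / 2) * decay (m + 1) t.gen := by
  have he := (edge_pos hℓ t.gen).le
  rw [B_of_ne ht, bridge, volume_box, zero_sub, neg_neg, decay_eq_ofReal,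
    ← ENNReal.ofReal_pow he, ← ENNReal.ofReal_mul (by positivity),
    ← ENNReal.ofReal_mul (by positivity),
    Real.rpow_neg (by positivity), show ((m : ℝ) + 1) = ((m + 1 : ℕ) : ℝ) by push_cast; rfl,
    Real.rpow_natCast, edge, div_pow]
  congr 1
  field_simp
  ring

lemma volume_B_ne_zero (hℓ : 0 < ℓ) (t : WhitneyIndex ℓ φ) (ht : t ≠ a) : volume (B a t) ≠ 0 := by
  rw [volume_B hℓ ht]
  exact mul_ne_zero (ENNReal.ofReal_pos.2 (by positivity)).ne' (decay_ne_zero _ _)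

lemma volume_B_ne_top (hℓ : 0 < ℓ) (t : WhitneyIndex ℓ φ) : volume (B a t) ≠ ∞ := by
  by_cases ht : t = a
  · rw [ht, B_root, measure_empty]
    simp
  · rw [volume_B hℓ ht]
    exact ENNReal.mul_ne_top ENNReal.ofReal_ne_top (decay_ne_top _ _)

section Holder

variable (hℓ : 0 < ℓ) (hα : 0 < α) (hφ : HolderOnWith K α φ (centeredCube m (3 * ℓ / 2)))
  (hφ_range : ∀ y ∈ centeredCube m (3 * ℓ / 2), 2 * ℓ ≤ φ y ∧ φ y < 3 * ℓ)

include hℓ hα hφ hφ_range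

/-- A covering set meets only finitely many others, as their edges are comparable. -/
lemma finite_inter (t : WhitneyIndex ℓ φ) : {s | (U a t ∩ U a s).Nonempty}.Finite := by
  refine (finite_gen_le hℓ hφ_range (5 * (m + 1) * 2 ^ t.gen)).subset ?_
  rintro s ⟨x, hxt, hxs⟩
  have h1 := edge_le_distGraph hℓ t.isWhitney.good x (U_subset_extendedCell hℓ t hxt)
  have h2 := distGraph_le hℓ hα hφ hφ_range s.isWhitney (U_subset_extendedCell hℓ s hxs)
  have h3 := h1.trans h2
  rw [edge, edge, ← mul_div_assoc, div_le_div_iff₀ (by positivity) (by positivity)] at h3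
  have h4 : (2 : ℝ) ^ s.gen ≤ 5 * (m + 1) * 2 ^ t.gen := by
    refine le_of_mul_le_mul_left ?_ hℓ
    linarith
  have h5 : 2 ^ s.gen ≤ 5 * (m + 1) * 2 ^ t.gen := by exact_mod_cast h4
  exact Nat.lt_two_pow_self.le.trans h5

lemma finite_children (ha : a.gen = 0 ∧ a.idx = 0) (t : WhitneyIndex ℓ φ) :
    {c | c ≠ a ∧ parent hℓ c = t}.Finite := by
  refine (finite_inter (a := a) hℓ hα hφ hφ_range t).subset ?_
  rintro c ⟨hca, rfl⟩
  obtain ⟨x, hx⟩ := nonempty_of_measure_ne_zero (volume_B_ne_zero hℓ c hca)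
  exact ⟨x, Q_subset_U hℓ _ (B_subset hℓ ha c hca hx), B_subset_U hℓ c hx⟩

lemma isCellTree (ha : a.gen = 0 ∧ a.idx = 0) :
    IsCellTree volume (parent hℓ) layer a Q (B a) where
  par_root := parent_root hℓ ha
  rank_lt := layer_parent_lt hℓ ha
  finite_children := finite_children hℓ hα hφ hφ_range ha
  measurable_Q := measurableSet_Q
  measurable_B t := (isOpen_B t).measurableSet
  disjoint_Q := disjoint_Q hℓ
  disjoint_B := disjoint_B hℓ ha
  B_root := B_root a
  B_subset := B_subset hℓ ha
  measure_B_ne_zero := volume_B_ne_zero hℓ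
  measure_B_ne_top := volume_B_ne_top hℓ

omit hφ_range in
lemma volume_diff_iUnion_Q :
    volume (graphRegion ℓ φ \ ⋃ t : WhitneyIndex ℓ φ, t.Q) = 0 := by
  refine measure_mono_null ?_ (ae_iff.1 (ae_notMem_grid (m := m) (ℓ := ℓ)))
  rintro x ⟨hx, hn⟩ hgrid
  exact hn (mem_iUnion.2 (exists_mem_cell hℓ hα hφ hx hgrid))

omit hφ_range in
lemma graphRegion_ae_eq : graphRegion ℓ φ =ᵐ[volume] ⋃ t : WhitneyIndex ℓ φ, t.Q :=
  ae_eq_set.2 ⟨volume_diff_iUnion_Q hℓ hα hφ, by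
    rw [sdiff_eq_empty.2 (iUnion_subset fun t => Q_subset hℓ t), measure_empty]⟩

end Holder

end WhitneyIndex

lemma tsum_indicator_le_one {Γ X : Type*} {S : Γ → Set X}
    (hS : Pairwise (Function.onFun Disjoint S)) (x : X) :
    ∑' t, (S t).indicator (1 : X → ℝ≥0∞) x ≤ 1 := by
  by_cases h : ∃ t, x ∈ S t
  · obtain ⟨t, ht⟩ := h
    rw [tsum_eq_single t fun s hs => indicator_of_notMem
      (fun hxs => (hS hs).le_bot ⟨hxs, ht⟩) _, indicator_of_mem ht, Pi.one_apply]
  · push Not at h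
    rw [ENNReal.tsum_eq_zero.2 fun t => indicator_of_notMem (h t) _]
    exact zero_le

namespace WhitneyIndex

variable {m : ℕ} {ℓ : ℝ} {φ : Eucl m → ℝ} {α K : ℝ≥0} {a : WhitneyIndex ℓ φ}

theorem isTreeCovering (hℓ : 0 < ℓ) (hα : 0 < α)
    (hφ : HolderOnWith K α φ (centeredCube m (3 * ℓ / 2)))
    (hφ_range : ∀ y ∈ centeredCube m (3 * ℓ / 2), 2 * ℓ ≤ φ y ∧ φ y < 3 * ℓ)
    (ha : a.gen = 0 ∧ a.idx = 0) :
    IsTreeCovering (graphRegion ℓ φ) (parentGraph (parent hℓ)) a (U a) (B a) where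
  isOpen := isOpen_U
  subset := U_subset hℓ ha
  ae_cover := measure_mono_null
    (sdiff_subset_sdiff_right (iUnion_mono fun t => Q_subset_U hℓ t))
    (volume_diff_iUnion_Q hℓ hα hφ)
  finite_inter := finite_inter hℓ hα hφ hφ_range
  overlap := by
    refine ⟨2, by norm_num, ?_⟩
    rw [Measure.restrict_congr_set (graphRegion_ae_eq hℓ hα hφ)]
    have hm : MeasurableSet (⋃ t : WhitneyIndex ℓ φ, t.Q) :=
      .iUnion measurableSet_Q
    filter_upwards [ae_restrict_mem hm, ae_restrict_of_ae (ae_notMem_grid (m := m) (ℓ := ℓ))]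
      with x hx hgrid
    obtain ⟨t, ht⟩ := mem_iUnion.1 hx
    rw [indicator_of_mem (Q_subset hℓ t ht), Pi.one_apply]
    constructor
    · refine le_trans ?_ (ENNReal.le_tsum t)
      rw [indicator_of_mem (Q_subset_U hℓ t ht), Pi.one_apply]
    -- off the grid the sets `U t` split into the disjoint cells and the disjoint bridges
    · calc ∑' t, (U a t).indicator (1 : Eucl (m + 1) → ℝ≥0∞) x
          ≤ ∑' t : WhitneyIndex ℓ φ, (t.Q.indicator (1 : Eucl (m + 1) → ℝ≥0∞) x +
              (B a t).indicator (1 : Eucl (m + 1) → ℝ≥0∞) x) := by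
            refine ENNReal.tsum_le_tsum fun s => ?_
            by_cases hs : x ∈ U a s
            · rw [indicator_of_mem hs]
              by_cases hQ : x ∈ s.Q
              · rw [indicator_of_mem hQ]
                exact le_self_add
              · have hsa : s ≠ a := by
                  rintro rfl
                  exact hQ (U_root s ▸ hs)
                rw [U_of_ne hsa] at hs
                have hB : x ∈ B a s := by
                  rw [B_of_ne hsa]
                  rcases extendedCell_subset_union hs with (h | h) | h
                  · exact absurd h hQ
                  · exact h
                  · exact absurd h (hgrid _ _ _)
                rw [indicator_of_mem hB]
                exact le_add_self
            · rw [indicator_of_notMem hs]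
              exact zero_le
        _ ≤ 1 + 1 := by
            rw [ENNReal.tsum_add]
            exact add_le_add (tsum_indicator_le_one (disjoint_Q hℓ) x)
              (tsum_indicator_le_one (disjoint_B hℓ ha) x)
        _ = _ := by norm_num
  isTree := parentGraph_isTree (parent_root hℓ ha) (layer_parent_lt hℓ ha)
  finite_children s := (finite_children hℓ hα hφ hφ_range ha s).subset fun _ ht =>
    ht.par_eq (parent_root hℓ ha) (layer_parent_lt hℓ ha)
  isOpen_B t _ := isOpen_B t
  disjoint_B _ _ _ _ h := disjoint_B hℓ ha h
  B_subset s t h := by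
    obtain ⟨hta, rfl⟩ := h.par_eq (parent_root hℓ ha) (layer_parent_lt hℓ ha)
    exact subset_inter (B_subset_U hℓ t) ((B_subset hℓ ha t hta).trans (Q_subset_U hℓ _))

theorem isWhitneyType (hℓ : 0 < ℓ) (hα : 0 < α)
    (hφ : HolderOnWith K α φ (centeredCube m (3 * ℓ / 2)))
    (hφ_range : ∀ y ∈ centeredCube m (3 * ℓ / 2), 2 * ℓ ≤ φ y ∧ φ y < 3 * ℓ) :
    IsWhitneyType (graphRegion ℓ φ) (distGraph ℓ φ) a (U a) (B a)
      (fun t => corner ℓ t.gen t.idx) (fun t => edge ℓ t.gen) where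
  edge_pos t := edge_pos hℓ _
  disjoint_cubes _ _ h := disjoint_Q hℓ h
  ae_cover_cubes := volume_diff_iUnion_Q hℓ hα hφ
  root_eq := U_root a
  U_eq _ h := U_of_ne h
  B_eq _ h := B_of_ne h
  edge_comparable := by
    refine ⟨1, 5 * (m + 1), one_pos, by positivity, fun t x hx => ?_⟩
    have hx' := U_subset_extendedCell hℓ t hx
    rw [one_mul]
    exact ⟨edge_le_distGraph hℓ t.isWhitney.good x hx',
      distGraph_le hℓ hα hφ hφ_range t.isWhitney hx'⟩

end WhitneyIndex

/-! ### The weighted estimate -/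

namespace WhitneyIndex

variable {m : ℕ} {ℓ : ℝ} {φ : Eucl m → ℝ} {α K : ℝ≥0} {a : WhitneyIndex ℓ φ}

/-- Powers of the distance to the graph are comparable to the corresponding powers of the edge. -/
lemma exists_distGraph_rpow_bounds (hℓ : 0 < ℓ) (hα : 0 < α)
    (hφ : HolderOnWith K α φ (centeredCube m (3 * ℓ / 2)))
    (hφ_range : ∀ y ∈ centeredCube m (3 * ℓ / 2), 2 * ℓ ≤ φ y ∧ φ y < 3 * ℓ) (θ : ℝ) :
    ∃ C : ℝ≥0∞, C ≠ ∞ ∧ ∀ t : WhitneyIndex ℓ φ, ∀ x ∈ extendedCell ℓ t.gen t.idx,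
      ENNReal.ofReal (distGraph ℓ φ x ^ θ) ≤ C * decay θ t.gen ∧
      decay θ t.gen ≤ C * ENNReal.ofReal (distGraph ℓ φ x ^ θ) := by
  set c : ℝ := 5 * (m + 1) * ℓ
  have hc0 : 0 < c := by positivity
  have bound : ∀ (y θ : ℝ), ℓ ≤ y → y ≤ c → y ^ θ ≤ ℓ ^ θ + c ^ θ := by
    intro y θ h1 h2
    have hy : 0 < y := hℓ.trans_le h1
    have p1 : 0 < ℓ ^ θ := by positivity
    have p2 : 0 < c ^ θ := by positivity
    rcases le_total 0 θ with h | h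
    · have := Real.rpow_le_rpow hy.le h2 h
      linarith
    · have := Real.rpow_le_rpow_of_nonpos hℓ h1 h
      linarith
  set D : ℝ := (ℓ ^ θ + c ^ θ) + (ℓ ^ (-θ) + c ^ (-θ))
  refine ⟨ENNReal.ofReal D, ENNReal.ofReal_ne_top, fun t x hx => ?_⟩
  have h2 : (0 : ℝ) < 2 ^ t.gen := by positivity
  have hlow := edge_le_distGraph hℓ t.isWhitney.good x hx
  have hup := distGraph_le hℓ hα hφ hφ_range t.isWhitney hx
  set d := distGraph ℓ φ x
  set y : ℝ := d * 2 ^ t.gen with hy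
  have hyl : ℓ ≤ y := by
    rw [edge, div_le_iff₀ h2] at hlow
    exact hlow
  have hyc : y ≤ c := by
    rw [edge, ← mul_div_assoc, le_div_iff₀ h2] at hup
    exact hup
  have hy0 : 0 < y := hℓ.trans_le hyl
  have hdy : d = y * (2 ^ t.gen)⁻¹ := by
    rw [hy]
    field_simp
  have hdθ : d ^ θ = y ^ θ * (2 ^ t.gen) ^ (-θ) := by
    rw [hdy, Real.mul_rpow hy0.le (by positivity), Real.inv_rpow h2.le, Real.rpow_neg h2.le]
  have hp : (0 : ℝ) < (2 ^ t.gen) ^ (-θ) := by positivity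
  have b1 := bound y θ hyl hyc
  have b2 := bound y (-θ) hyl hyc
  have q1 : 0 < y ^ θ := by positivity
  have q2 : 0 < y ^ (-θ) := by positivity
  have q3 : 0 < ℓ ^ θ + c ^ θ := by positivity
  have q4 : 0 < ℓ ^ (-θ) + c ^ (-θ) := by positivity
  have hD0 : 0 ≤ D := by linarith
  rw [decay_eq_ofReal, ← ENNReal.ofReal_mul hD0, ← ENNReal.ofReal_mul hD0, hdθ]
  constructor <;> apply ENNReal.ofReal_le_ofReal
  · gcongr
    linarith
  · rw [← mul_assoc]
    refine le_mul_of_one_le_left hp.le ?_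
    calc (1 : ℝ) = y ^ (-θ) * y ^ θ := by rw [← Real.rpow_add hy0, neg_add_cancel, Real.rpow_zero]
      _ ≤ D * y ^ θ := by
          gcongr
          linarith

/-- Hölder's inequality on one cell. -/
lemma lintegral_rpow_le (hℓ : 0 < ℓ) {p q : ℝ} (hpq : p.HolderConjugate q)
    {f : Eucl (m + 1) → ℝ} (t : WhitneyIndex ℓ φ)
    (hf : AEStronglyMeasurable f (volume.restrict t.Q)) :
    (∫⁻ x in t.Q, ‖f x‖ₑ) ^ q ≤ ENNReal.ofReal (ℓ ^ (m + 1)) ^ (q - 1) *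
      decay ((m + 1) * (q - 1)) t.gen * ∫⁻ x in t.Q, ‖f x‖ₑ ^ q := by
  have hq : 0 < q := hpq.symm.pos
  have h := ENNReal.lintegral_mul_le_Lp_mul_Lq (volume.restrict t.Q) hpq.symm hf.enorm
    (g := fun _ => 1) aemeasurable_const
  simp only [Pi.mul_apply, mul_one, ENNReal.one_rpow, lintegral_const, Measure.restrict_apply_univ,
    one_mul] at h
  calc (∫⁻ x in t.Q, ‖f x‖ₑ) ^ q
      ≤ ((∫⁻ x in t.Q, ‖f x‖ₑ ^ q) ^ (1 / q) * volume t.Q ^ (1 / p)) ^ q := by gcongr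
    _ = (∫⁻ x in t.Q, ‖f x‖ₑ ^ q) * volume t.Q ^ (q - 1) := by
        rw [ENNReal.mul_rpow_of_nonneg _ _ hq.le, ← ENNReal.rpow_mul, ← ENNReal.rpow_mul,
          one_div_mul_cancel hq.ne', ENNReal.rpow_one, one_div, inv_mul_eq_div,
          hpq.symm.div_conj_eq_sub_one]
    _ = _ := by
        rw [volume_Q hℓ, ENNReal.mul_rpow_of_nonneg _ _ hpq.symm.sub_one_pos.le, decay_rpow]
        ring

/-- The mass of the shadow of `t` is the sum of the masses of the cells of its descendants. -/
lemma lintegral_shadow (hℓ : 0 < ℓ) (f : Eucl (m + 1) → ℝ) (t : WhitneyIndex ℓ φ) :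
    ∫⁻ x in shadow (parent hℓ) Q t, ‖f x‖ₑ =
      ∑' s : WhitneyIndex ℓ φ, ind (Descends (parent hℓ) t s) * ∫⁻ x in s.Q, ‖f x‖ₑ := by
  rw [shadow, lintegral_biUnion (to_countable _)
    (fun s _ => measurableSet_Q s) (fun s _ t _ h => disjoint_Q hℓ h),
    tsum_subtype {s | Descends (parent hℓ) t s} fun s => ∫⁻ x in s.Q, ‖f x‖ₑ]
  refine tsum_congr fun s => ?_
  by_cases h : Descends (parent hℓ) t s
  · rw [ind_of h, one_mul, indicator_of_mem (s := {s | Descends (parent hℓ) t s}) h]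
  · rw [ind_of_not h, zero_mul, indicator_of_notMem (s := {s | Descends (parent hℓ) t s}) h]

/-- Up to constants, the cost of transporting the mass of the shadow of `t` across the bridge of
`t` is the `t`-th term of the left-hand side of the discrete Hardy inequality. -/
lemma flux_rpow_mul_le (hℓ : 0 < ℓ) {q : ℝ} (hq : 1 < q) {θ : ℝ} {C : ℝ≥0∞}
    {w : Eucl (m + 1) → ℝ≥0∞}
    (hw : ∀ t : WhitneyIndex ℓ φ, ∀ x ∈ extendedCell ℓ t.gen t.idx, w x ≤ C * decay θ t.gen)
    (f : Eucl (m + 1) → ℝ) (t : WhitneyIndex ℓ φ) :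
    ‖flux volume (parent hℓ) Q (B a) f t‖ₑ ^ q * ∫⁻ x in B a t, w x ≤
      C * ENNReal.ofReal (ℓ ^ (m + 1) / 2) ^ (1 - q) * (decay ((m + 1) * (1 - q) + θ) t.gen *
        (∑' s : WhitneyIndex ℓ φ, ind (Descends (parent hℓ) t s) *
          ∫⁻ x in s.Q, ‖f x‖ₑ) ^ q) := by
  have hq0 : 0 < q := by linarith
  by_cases ht : t = a
  · rw [ht, B_root, setLIntegral_empty, mul_zero]
    exact zero_le
  have hV0 := volume_B_ne_zero hℓ t ht
  have hVt := volume_B_ne_top (a := a) hℓ t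
  set V := volume (B a t) with hV
  rw [← lintegral_shadow hℓ]
  set S := ∫⁻ x in shadow (parent hℓ) Q t, ‖f x‖ₑ
  have h1 : ‖flux volume (parent hℓ) Q (B a) f t‖ₑ ≤ S * V⁻¹ := by
    have : ‖(volume.real (B a t))⁻¹‖ₑ = V⁻¹ := by
      rw [measureReal_def, ← hV, enorm_inv (ENNReal.toReal_ne_zero.2 ⟨hV0, hVt⟩),
        Real.enorm_of_nonneg ENNReal.toReal_nonneg, ENNReal.ofReal_toReal hVt]
    rw [flux, div_eq_mul_inv, enorm_mul, this]
    gcongr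
    exact enorm_integral_le_lintegral_enorm _
  have h2 : ∫⁻ x in B a t, w x ≤ C * decay θ t.gen * V := by
    rw [← setLIntegral_const]
    refine setLIntegral_mono' (isOpen_B t).measurableSet fun x hx => hw t x ?_
    exact U_subset_extendedCell hℓ t (B_subset_U hℓ t hx)
  have h3 : V ^ (1 - q) = ENNReal.ofReal (ℓ ^ (m + 1) / 2) ^ (1 - q) *
      decay ((m + 1) * (1 - q)) t.gen := by
    rw [hV, volume_B hℓ ht, ENNReal.mul_rpow_of_ne_zero
      (ENNReal.ofReal_pos.2 (by positivity)).ne' (decay_ne_zero _ _), decay_rpow]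
  calc _ ≤ (S * V⁻¹) ^ q * (C * decay θ t.gen * V) := by gcongr
    _ = S ^ q * C * decay θ t.gen * (V ^ (-q) * V) := by
        rw [ENNReal.mul_rpow_of_nonneg _ _ hq0.le, ENNReal.inv_rpow, ← ENNReal.rpow_neg]
        ring
    _ = S ^ q * C * decay θ t.gen * V ^ (1 - q) := by
        nth_rewrite 2 [← ENNReal.rpow_one V]
        rw [← ENNReal.rpow_add _ _ hV0 hVt]
        ring_nf
    _ = _ := by
        rw [h3, ← decay_mul]
        ring

lemma ofReal_abs_rpow_mul {d θ q : ℝ} (hd : 0 ≤ d) (hq : 0 ≤ q) (y : ℝ) :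
    ENNReal.ofReal (|y| ^ q * (d ^ θ) ^ (-q)) = ‖y‖ₑ ^ q * ENNReal.ofReal (d ^ (-(θ * q))) := by
  rw [ENNReal.ofReal_mul (by positivity), ← ENNReal.ofReal_rpow_of_nonneg (abs_nonneg y) hq,
    ← Real.enorm_eq_ofReal_abs, ← Real.rpow_mul hd, mul_neg]

/-- The Hardy inequality for the masses of the shadows. -/
lemma exists_hardy (hℓ : 0 < ℓ) (hα : 0 < α) (hα1 : α ≤ 1)
    (hφ : HolderOnWith K α φ (centeredCube m (3 * ℓ / 2)))
    (hφ_range : ∀ y ∈ centeredCube m (3 * ℓ / 2), 2 * ℓ ≤ φ y ∧ φ y < 3 * ℓ)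
    {p q β : ℝ} (hpq : p.HolderConjugate q) (hβ : -(α : ℝ) < β * p) :
    ∃ C : ℝ≥0∞, C ≠ ∞ ∧ ∀ f : Eucl (m + 1) → ℝ,
      AEStronglyMeasurable f (volume.restrict (⋃ t : WhitneyIndex ℓ φ, t.Q)) →
      ∑' t : WhitneyIndex ℓ φ, decay ((m + 1) * (1 - q) + -((β + α - 1) * q)) t.gen *
        (∑' s : WhitneyIndex ℓ φ, ind (Descends (parent hℓ) t s) * ∫⁻ x in s.Q, ‖f x‖ₑ) ^ q ≤
      C * ∫⁻ x in ⋃ t : WhitneyIndex ℓ φ, t.Q,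
        ‖f x‖ₑ ^ q * ENNReal.ofReal (distGraph ℓ φ x ^ (-(β * q))) := by
  obtain ⟨M, hM, hcol⟩ := exists_column_bound hℓ hα hα1 hφ hφ_range
  obtain ⟨C₁, hC₁, hhardy⟩ := discrete_hardy hM hcol
    (fun t s h => gen_le_of_descends hℓ (s := s) (t := t) h) hpq hβ
  obtain ⟨C₂, hC₂, hdist⟩ := exists_distGraph_rpow_bounds hℓ hα hφ hφ_range (-(β * q))
  set c : ℝ≥0∞ := ENNReal.ofReal (ℓ ^ (m + 1)) ^ (q - 1)
  have hct : c ≠ ∞ :=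
    ENNReal.rpow_ne_top_of_nonneg hpq.symm.sub_one_pos.le ENNReal.ofReal_ne_top
  refine ⟨C₁ * (c * C₂), ENNReal.mul_ne_top hC₁ (ENNReal.mul_ne_top hct hC₂), fun f hf => ?_⟩
  refine (hhardy fun s => ∫⁻ x in s.Q, ‖f x‖ₑ).trans ?_
  rw [mul_assoc]
  gcongr
  rw [lintegral_iUnion measurableSet_Q (disjoint_Q hℓ),
    ← ENNReal.tsum_mul_left]
  refine ENNReal.tsum_le_tsum fun s => ?_
  calc decay ((m + 1) * (1 - q) - β * q) s.gen * (∫⁻ x in s.Q, ‖f x‖ₑ) ^ q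
      ≤ decay ((m + 1) * (1 - q) - β * q) s.gen * (c * decay ((m + 1) * (q - 1)) s.gen *
          ∫⁻ x in s.Q, ‖f x‖ₑ ^ q) := by
        gcongr
        exact lintegral_rpow_le hℓ hpq s
          (hf.mono_measure (Measure.restrict_mono (subset_iUnion Q s) le_rfl))
    _ = c * (decay ((m + 1) * (1 - q) - β * q) s.gen * decay ((m + 1) * (q - 1)) s.gen *
          ∫⁻ x in s.Q, ‖f x‖ₑ ^ q) := by ring
    _ = c * ∫⁻ x in s.Q, ‖f x‖ₑ ^ q * decay (-(β * q)) s.gen := by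
        rw [decay_mul, lintegral_mul_const' _ _ (decay_ne_top _ _), mul_comm (decay _ _)]
        congr 3
        ring
    _ ≤ c * ∫⁻ x in s.Q, C₂ * (‖f x‖ₑ ^ q *
          ENNReal.ofReal (distGraph ℓ φ x ^ (-(β * q)))) := by
        gcongr c * ?_
        refine setLIntegral_mono' s.measurableSet_Q fun x hx => ?_
        rw [mul_left_comm]
        gcongr
        exact (hdist s x (cell_subset_extendedCell hℓ hx)).2
    _ = _ := by
        rw [lintegral_const_mul' _ _ hC₂, mul_assoc]

theorem exists_decomposition (hℓ : 0 < ℓ) (hα : 0 < α) (hα1 : α ≤ 1)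
    (hφ : HolderOnWith K α φ (centeredCube m (3 * ℓ / 2)))
    (hφ_range : ∀ y ∈ centeredCube m (3 * ℓ / 2), 2 * ℓ ≤ φ y ∧ φ y < 3 * ℓ)
    (ha : a.gen = 0 ∧ a.idx = 0)
    {p q β : ℝ} (hpq : p.HolderConjugate q) (hβ : -(α : ℝ) < β * p) :
    ∃ C : ℝ≥0, ∀ f : Eucl (m + 1) → ℝ,
      MemWeightedLp (graphRegion ℓ φ) (fun x => distGraph ℓ φ x ^ (-(β * q))) q f →
      ∫ x in graphRegion ℓ φ, f x = 0 →
      ∃ fs : WhitneyIndex ℓ φ → Eucl (m + 1) → ℝ,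
        IsCDecomposition (graphRegion ℓ φ) (U a) f fs ∧
        DecompositionEstimate (graphRegion ℓ φ) (U a)
          (fun x => distGraph ℓ φ x ^ β)
          (fun x => distGraph ℓ φ x ^ (β + α - 1)) q C f fs := by
  have hq : 1 < q := hpq.symm.lt
  have hq0 : 0 < q := hpq.symm.pos
  obtain ⟨C₁, hC₁, hhardy⟩ := exists_hardy hℓ hα hα1 hφ hφ_range hpq hβ
  obtain ⟨C₂, hC₂, hν⟩ := exists_distGraph_rpow_bounds hℓ hα hφ hφ_range (-((β + α - 1) * q))
  obtain ⟨C₃, hC₃, hω⟩ := exists_distGraph_rpow_bounds hℓ hα hφ hφ_range (-(β * q))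
  have htree := isCellTree hℓ hα hφ hφ_range ha
  have hΩ := graphRegion_ae_eq hℓ hα hφ
  set Ω' : Set (Eucl (m + 1)) := ⋃ t : WhitneyIndex ℓ φ, t.Q with hΩ'
  have hΩm : MeasurableSet Ω' := .iUnion measurableSet_Q
  have hd0 : ∀ x, 0 ≤ distGraph ℓ φ x := fun x => Metric.infDist_nonneg
  set w : Eucl (m + 1) → ℝ≥0∞ :=
    fun x => ENNReal.ofReal (distGraph ℓ φ x ^ (-((β + α - 1) * q)))
  have hwm : Measurable w :=
    ((Metric.continuous_infDist_pt _).measurable.pow_const _).ennreal_ofReal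
  set c : ℝ≥0∞ := 2 ^ (q - 1)
  have hct : c ≠ ∞ := ENNReal.rpow_ne_top_of_nonneg (by linarith) (by simp)
  set D : ℝ≥0∞ := C₂ * ENNReal.ofReal (ℓ ^ (m + 1) / 2) ^ (1 - q)
  have hDt : D ≠ ∞ := ENNReal.mul_ne_top hC₂ (ENNReal.rpow_ne_top_of_ne_zero
    (ENNReal.ofReal_pos.2 (by positivity)).ne' ENNReal.ofReal_ne_top)
  set C : ℝ≥0∞ := c * (C₂ * C₃) + (c + 1) * (D * C₁) with hCdef
  have hCt : C ≠ ∞ := ENNReal.add_ne_top.2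
    ⟨ENNReal.mul_ne_top hct (ENNReal.mul_ne_top hC₂ hC₃),
      ENNReal.mul_ne_top (ENNReal.add_ne_top.2 ⟨hct, ENNReal.one_ne_top⟩)
        (ENNReal.mul_ne_top hDt hC₁)⟩
  refine ⟨C.toNNReal, fun f hf hf0 => ?_⟩
  obtain ⟨hfm, hfi⟩ := hf
  rw [Measure.restrict_congr_set hΩ] at hfm
  rw [setIntegral_congr_set hΩ] at hf0
  set I : ℝ≥0∞ := ∫⁻ x in Ω', ‖f x‖ₑ ^ q * ENNReal.ofReal (distGraph ℓ φ x ^ (-(β * q))) with hI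
  have hIt : I ≠ ∞ := by
    have h1 := (hfi.congr_set_ae hΩ.symm).integrable.lintegral_lt_top
    refine ne_of_lt (lt_of_eq_of_lt (lintegral_congr fun x => ?_) h1)
    rw [ENNReal.ofReal_mul (by positivity), ← ENNReal.ofReal_rpow_of_nonneg (abs_nonneg _) hq0.le,
      ← Real.enorm_eq_ofReal_abs]
  have hH := hhardy f hfm
  rw [← hI] at hH
  -- the term of the Hardy inequality at the root bounds the `L¹` norm of `f`
  have hfint : IntegrableOn f Ω' := by
    refine ⟨hfm, ?_⟩
    rw [hasFiniteIntegral_iff_enorm, hΩ', ← shadow_root htree, lintegral_shadow hℓ]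
    have h1 := ((ENNReal.le_tsum a).trans hH).trans_lt
      (ENNReal.mul_lt_top hC₁.lt_top hIt.lt_top)
    by_contra hn
    rw [not_lt, top_le_iff] at hn
    rw [hn, ENNReal.top_rpow_of_pos hq0, ENNReal.mul_top (decay_ne_zero _ _)] at h1
    exact lt_irrefl _ h1
  have hsupp : ∀ t, Function.support (cellPart volume (parent hℓ) Q (B a) f t) ⊆ U a t :=
    fun t => (support_cellPart t).trans (union_subset (Q_subset_U hℓ t) (B_subset_U hℓ t))
  refine ⟨cellPart volume (parent hℓ) Q (B a) f, ⟨?_, ?_, fun t => ?_, ?_, hsupp, fun t => ?_⟩, ?_⟩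
  · exact hfint.congr_set_ae hΩ
  · rwa [setIntegral_congr_set hΩ]
  · exact (integrable_cellPart htree hfint t).integrableOn
  · rw [Measure.restrict_congr_set hΩ]
    exact ae_restrict_of_forall_mem hΩm fun x hx => hasSum_cellPart htree hx
  · rw [setIntegral_eq_integral_of_forall_compl_eq_zero fun x hx =>
      Function.notMem_support.1 fun h => hx (hsupp t h)]
    exact integral_cellPart htree hfint hf0 t
  · rw [DecompositionEstimate, ENNReal.coe_toNNReal hCt, setLIntegral_congr hΩ]
    simp only [ofReal_abs_rpow_mul (hd0 _) hq0.le]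
    rw [← hI]
    have hfpart : ∫⁻ x in Ω', ‖f x‖ₑ ^ q * w x ≤ C₂ * C₃ * I := by
      rw [hI, ← lintegral_const_mul' _ _ (ENNReal.mul_ne_top hC₂ hC₃)]
      refine setLIntegral_mono' hΩm fun x hx => ?_
      obtain ⟨t, ht⟩ := mem_iUnion.1 hx
      have hxt := cell_subset_extendedCell hℓ ht
      rw [mul_left_comm]
      gcongr
      -- `ν ^ (-q)` is at most `e ^ ((1 - α) q) ω ^ (-q)`, and `α ≤ 1`
      calc w x ≤ C₂ * decay (-((β + α - 1) * q)) t.gen := (hν t x hxt).1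
        _ = C₂ * (decay (-(β * q)) t.gen * decay ((1 - α) * q) t.gen) := by
            rw [decay_mul]
            ring_nf
        _ ≤ C₂ * ((C₃ * ENNReal.ofReal (distGraph ℓ φ x ^ (-(β * q)))) * 1) := by
            have hα1' : (0 : ℝ) ≤ 1 - α := sub_nonneg.2 (by exact_mod_cast hα1)
            gcongr
            · exact (hω t x hxt).2
            · exact decay_le_one (by positivity) _
        _ = _ := by ring
    have hflux : ∑' t, ‖flux volume (parent hℓ) Q (B a) f t‖ₑ ^ q * ∫⁻ x in B a t, w x ≤
        D * (C₁ * I) := by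
      calc _ ≤ ∑' t : WhitneyIndex ℓ φ,
            D * (decay ((m + 1) * (1 - q) + -((β + α - 1) * q)) t.gen *
              (∑' s : WhitneyIndex ℓ φ, ind (Descends (parent hℓ) t s) *
                ∫⁻ x in s.Q, ‖f x‖ₑ) ^ q) :=
            ENNReal.tsum_le_tsum fun t =>
              flux_rpow_mul_le hℓ hq (fun t x hx => (hν t x hx).1) f t
        _ ≤ _ := by
            rw [ENNReal.tsum_mul_left]
            gcongr
    calc _ ≤ ∑' t, ∫⁻ x, ‖cellPart volume (parent hℓ) Q (B a) f t x‖ₑ ^ q * w x :=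
          ENNReal.tsum_le_tsum fun t => setLIntegral_le_lintegral _ _
      _ ≤ c * (∫⁻ x in Ω', ‖f x‖ₑ ^ q * w x) + (c + 1) *
            ∑' t, ‖flux volume (parent hℓ) Q (B a) f t‖ₑ ^ q * ∫⁻ x in B a t, w x :=
          tsum_lintegral_cellPart_le htree hq.le hwm
      _ ≤ c * (C₂ * C₃ * I) + (c + 1) * (D * (C₁ * I)) := by gcongr
      _ = C * I := by
          rw [hCdef]
          ring

end WhitneyIndex

end HolderDecomposition

theorem mainTheorem8 (m : ℕ) (hm : 1 ≤ m) (ℓ : ℝ) (hℓ : 0 < ℓ)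
    (α K : ℝ≥0) (hα0 : 0 < α) (hα1 : α ≤ 1)
    (φ : HolderDecomposition.Eucl m → ℝ)
    (hφ : HolderOnWith K α φ (HolderDecomposition.centeredCube m (3 * ℓ / 2)))
    (hφ_range : ∀ y ∈ HolderDecomposition.centeredCube m (3 * ℓ / 2),
      2 * ℓ ≤ φ y ∧ φ y < 3 * ℓ) :
    ∃ (Γ : Type) (T : SimpleGraph Γ) (a : Γ)
      (U B : Γ → Set (HolderDecomposition.Eucl (m + 1)))
      (z : Γ → HolderDecomposition.Eucl (m + 1)) (e : Γ → ℝ),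
      HolderDecomposition.IsTreeCovering (HolderDecomposition.graphRegion ℓ φ) T a U B ∧
      HolderDecomposition.IsWhitneyType (HolderDecomposition.graphRegion ℓ φ)
        (HolderDecomposition.distGraph ℓ φ) a U B z e ∧
      ∀ p q β : ℝ, p.HolderConjugate q → -(α : ℝ) < β * p →
        ∃ C : ℝ≥0, ∀ f : HolderDecomposition.Eucl (m + 1) → ℝ,
          HolderDecomposition.MemWeightedLp (HolderDecomposition.graphRegion ℓ φ)
            (fun x => HolderDecomposition.distGraph ℓ φ x ^ (-(β * q))) q f →
          ∫ x in HolderDecomposition.graphRegion ℓ φ, f x = 0 →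
          ∃ fs : Γ → HolderDecomposition.Eucl (m + 1) → ℝ,
            HolderDecomposition.IsCDecomposition
              (HolderDecomposition.graphRegion ℓ φ) U f fs ∧
            HolderDecomposition.DecompositionEstimate
              (HolderDecomposition.graphRegion ℓ φ) U
              (fun x => HolderDecomposition.distGraph ℓ φ x ^ β)
              (fun x => HolderDecomposition.distGraph ℓ φ x ^ (β + α - 1)) q C f fs := by
  obtain ⟨a, ha⟩ := HolderDecomposition.WhitneyIndex.exists_root (ℓ := ℓ) hφ_range
  exact ⟨HolderDecomposition.WhitneyIndex ℓ φ,
    HolderDecomposition.parentGraph (HolderDecomposition.WhitneyIndex.parent hℓ), a,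
    HolderDecomposition.WhitneyIndex.U a, HolderDecomposition.WhitneyIndex.B a, _, _,
    HolderDecomposition.WhitneyIndex.isTreeCovering hℓ hα0 hφ hφ_range ha,
    HolderDecomposition.WhitneyIndex.isWhitneyType hℓ hα0 hφ hφ_range,
    fun _ _ _ hpq hβ =>
      HolderDecomposition.WhitneyIndex.exists_decomposition hℓ hα0 hα1 hφ hφ_range ha hpq hβ⟩
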